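/- **Setting.** Let $n=2^{k_n}$ with $k_n\ge 0$ an integer, $s\in\mathbb R^n$, $\sigma\in(0,\infty)^n$ and $\gamma\ge 1$ with $\max_i\sigma_i\le\gamma\min_i\sigma_i$. For $t\in\mathbb R^n$ and $\tau\in(0,\infty)^n$ let $P_{t,\tau}$ be the law of a Gaussian vector with mean $t$ and covariance matrix $\mathrm{diag}(\tau_1,\dots,\tau_n)$, and let $\mathcal K(P_{s,\sigma},P_{t,\tau})$ be the Kullback-Leibler divergence, $$\mathcal K(P_{s,\sigma},P_{t,\tau})=\frac12\sum_{i=1}^n\left(\frac{(s_i-t_i)^2}{\tau_i}+\log\frac{\tau_i}{\sigma_i}+\frac{\sigma_i}{\tau_i}-1\right).$$ Let $Y^{[1]},Y^{[2]}$ be two independent random vectors with law $P_{s,\sigma}$. Let $\mathcal M$ be a finite or countable set. To each $m\in\mathcal M$ are attached an integer $0\le k_m\le k_n$, the partition $p_m$ of $\{1,\dots,n\}$ into $|p_m|=2^{k_m}$ consecutive blocks of length $2^{k_n-k_m}$, and a linear subspace $E_m$ of $\mathbb R^{2^{k_n-k_m}}$ of dimension $d_m\ge1$. Let $S_m=\{x\in\mathbb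 R^n:\ x_{|I}\in E_m \text{ for all } I\in p_m\}$, let $\pi_m$ be the orthogonal projection of $\mathbb R^n$ onto $S_m$, and let $\Sigma_m$ be the space of the vectors that are constant on each block of $p_m$; thus $D_m=|p_m|(d_m+1)$ is the dimension of $S_m\times\Sigma_m$. Put $$\hat s_m=\pi_mY^{[1]},\qquad \hat\sigma_{m,i}=\frac1{|I|}\sum_{j\in I}\left(Y^{[2]}_j-(\pi_mY^{[2]})_j\right)^2\quad\text{for } i\in I\in p_m .$$ Given a function $\mathrm{pen}:\mathcal M\to[0,\infty)$, let $\hat m$ be any (measurable) random element of $\mathcal M$ that almost surely minimizes over $m \in \mathcal M$ $$\mathcal L(\hat s_m,\hat\sigma_m)+\mathrm{pen}(m),\qquad \mathcal L(t,\tau)=\frac12\sum_{i=1}^n\left(\frac{(Y^{[1]}_i-t_i)^2}{\tau_i}+\log\tau_i\right),$$ and let $(\tilde s,\tilde\sigma)=(\hat s_{\hat m},\hat\sigma_{\hat m})$. **Theorem.** Let $\theta>1$ be such that $n\ge\frac{\theta}{\theta-1}(\gamma+2)D_m$ for all $m\in\mathcal M$ (hypothesis $(H_\theta)$). Let $\alpha\in(0,1)$,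 let $(x_m)_{m\in\mathcal M}$ be positive numbers, and suppose that $\mathrm{pen}(m)\ge\gamma\theta D_m+x_m$ for all $m\in\mathcal M$. Then $$(1-\alpha)\,\mathbb E\left[\mathcal K(P_{s,\sigma},P_{\tilde s,\tilde\sigma})\right]\le\inf_{m\in\mathcal M}\left\{\mathbb E\left[\mathcal K(P_{s,\sigma},P_{\hat s_m,\hat\sigma_m})\right]+\mathrm{pen}(m)\right\}+R_1(\mathcal M)+R_2(\mathcal M),$$ where, with $C=12\sqrt{2e}/(\sqrt e-1)$, $$R_1(\mathcal M)=C\theta^2\gamma\sum_{m\in\mathcal M}\sqrt{|p_m|}\,d_m\left(\frac{2C\theta^2\gamma\sqrt{|p_m|}\,d_m\log(1+d_m)}{x_m}\right)^{\lfloor2\log(1+d_m)\rfloor},$$ $$R_2(\mathcal M)=\frac{2(\alpha+\gamma\theta)+1}{\alpha}\sum_{m\in\mathcal M}|p_m|\exp\left(-\frac{n}{2\theta|p_m|}\log\left(1+\frac{\alpha|p_m|x_m}{\gamma n(\alpha+2)}\right)\right).$$ Both sides are read in $[0,\infty]$ (the sums $R_1,R_2$ may diverge). -/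

import Mathlib

open MeasureTheory ProbabilityTheory
open scoped ENNReal

noncomputable section

namespace HeteroGauss

/-- The law `P_{t,τ}` on `ℝⁿ` of a Gaussian vector with mean `t` and diagonal covariance matrix
`diag(τ₁, …, τₙ)`: its coordinates are independent, the `i`-th one being `N(tᵢ, τᵢ)`.
It is only meant for `τᵢ ≥ 0`. -/
def gaussianLaw {n : ℕ} (t τ : Fin n → ℝ) : Measure (Fin n → ℝ) :=
  Measure.pi fun i => gaussianReal (t i) (τ i).toNNReal

/-- The Kullback-Leibler divergence `K(P_{s,σ}, P_{t,τ})`, with values in `[0, ∞]`. -/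
def kullback {n : ℕ} (s σ t τ : Fin n → ℝ) : ℝ≥0∞ :=
  InformationTheory.klDiv (gaussianLaw s σ) (gaussianLaw t τ)

section KL
variable {n : ℕ}

lemma gaussianReal_eq_withDensity (s t : ℝ) {v w : NNReal} (hv : v ≠ 0) (hw : w ≠ 0) :
    gaussianReal s v = (gaussianReal t w).withDensity
      (fun x => ENNReal.ofReal (gaussianPDFReal s v x / gaussianPDFReal t w x)) := by
  rw [gaussianReal_of_var_ne_zero s hv, gaussianReal_of_var_ne_zero t hw,
    ← withDensity_mul (g := fun x =>
        ENNReal.ofReal (gaussianPDFReal s v x / gaussianPDFReal t w x)) _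
      (measurable_gaussianPDF t w)
      ((measurable_gaussianPDFReal s v).div (measurable_gaussianPDFReal t w)).ennreal_ofReal]
  congr 1
  ext x
  have := gaussianPDFReal_pos t w x hw
  rw [Pi.mul_apply, gaussianPDF, gaussianPDF, ← ENNReal.ofReal_mul this.le,
    mul_div_cancel₀ _ this.ne']

lemma pi_withDensity (μ : Fin n → Measure ℝ) [∀ i, IsProbabilityMeasure (μ i)]
    (f : Fin n → ℝ → ℝ≥0∞) (hf : ∀ i, Measurable (f i))
    [∀ i, SigmaFinite ((μ i).withDensity (f i))] :
    Measure.pi (fun i => (μ i).withDensity (f i)) =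
      (Measure.pi μ).withDensity (fun x => ∏ i, f i (x i)) := by
  refine Measure.pi_eq fun A hA => ?_
  rw [withDensity_apply _ (MeasurableSet.univ_pi hA), ← lintegral_indicator (MeasurableSet.univ_pi hA)]
  have h1 : ∀ x : Fin n → ℝ, (Set.univ.pi A).indicator (fun x => ∏ i, f i (x i)) x
      = ∏ i, (A i).indicator (f i) (x i) := by
    intro x
    by_cases hx : x ∈ Set.univ.pi A
    · rw [Set.indicator_of_mem hx]
      exact Finset.prod_congr rfl fun i _ => (Set.indicator_of_mem (hx i trivial) _).symm
    · rw [Set.indicator_of_notMem hx]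
      simp only [Set.mem_pi, not_forall] at hx
      obtain ⟨i, _, hi⟩ := hx
      exact (Finset.prod_eq_zero (Finset.mem_univ i) (Set.indicator_of_notMem hi _)).symm
  simp_rw [h1]
  have hm : ∀ i, Measurable ((A i).indicator (f i)) := fun i => (hf i).indicator (hA i)
  have hind : iIndepFun (fun (i : Fin n) (x : Fin n → ℝ) => (A i).indicator (f i) (x i))
      (Measure.pi μ) := iIndepFun_pi fun i => (hm i).aemeasurable
  rw [lintegral_prod_eq_prod_lintegral_of_indepFun Finset.univ _ hind
    (fun i => (hm i).comp (measurable_pi_apply i))]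
  refine Finset.prod_congr rfl fun i _ => ?_
  rw [withDensity_apply _ (hA i), ← lintegral_indicator (hA i)]
  exact (measurePreserving_eval μ i).lintegral_comp (hm i)

lemma log_pdf_div (s t x : ℝ) {v w : NNReal} (hv : v ≠ 0) (hw : w ≠ 0) :
    Real.log (gaussianPDFReal s v x / gaussianPDFReal t w x) =
      (1 / 2) * Real.log (w / v) + (x - t) ^ 2 / (2 * w) - (x - s) ^ 2 / (2 * v) := by
  have hv' : (0 : ℝ) < v := NNReal.coe_pos.2 (pos_iff_ne_zero.2 hv)
  have hw' : (0 : ℝ) < w := NNReal.coe_pos.2 (pos_iff_ne_zero.2 hw)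
  have h : ∀ (a : ℝ) (u : NNReal), 0 < (u : ℝ) → Real.log (gaussianPDFReal a u x) =
      -(1 / 2) * (Real.log (2 * Real.pi) + Real.log u) - (x - a) ^ 2 / (2 * u) := by
    intro a u hu
    rw [gaussianPDFReal, Real.log_mul (by positivity) (by positivity), Real.log_inv,
      Real.log_sqrt (by positivity), Real.log_mul (by positivity) (by positivity), Real.log_exp]
    ring
  rw [Real.log_div (gaussianPDFReal_pos s v x hv).ne' (gaussianPDFReal_pos t w x hw).ne',
    h s v hv', h t w hw', Real.log_div hw'.ne' hv'.ne']
  ring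

lemma integrable_sub_sq (s a : ℝ) (v : NNReal) :
    Integrable (fun x => (x - a) ^ 2) (gaussianReal s v) :=
  ((memLp_id_gaussianReal 2).sub (memLp_const a)).integrable_sq

lemma integral_sub_sq (s a : ℝ) (v : NNReal) :
    ∫ x, (x - a) ^ 2 ∂(gaussianReal s v) = v + (s - a) ^ 2 := by
  have h1 : ∫ x, (x - s) ^ 2 ∂(gaussianReal s v) = v := by
    have := variance_fun_id_gaussianReal (μ := s) (v := v)
    rw [variance_eq_integral (by fun_prop)] at this
    rw [integral_id_gaussianReal] at this
    exact this
  have h3 : Integrable (fun x : ℝ => x) (gaussianReal s v) :=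
    (memLp_id_gaussianReal 1).integrable (by simp)
  have h2 : ∀ x : ℝ, (x - a) ^ 2 = (x - s) ^ 2 + (2 * (s - a) * (x - s) + (s - a) ^ 2) := by
    intro x; ring
  have h4 : Integrable (fun x : ℝ => 2 * (s - a) * (x - s)) (gaussianReal s v) :=
    (h3.sub (integrable_const s)).const_mul _
  have h5 : Integrable (fun x : ℝ => 2 * (s - a) * (x - s) + (s - a) ^ 2) (gaussianReal s v) :=
    h4.add (integrable_const _)
  rw [integral_congr_ae (Filter.Eventually.of_forall h2),
    integral_add (integrable_sub_sq s s v) h5, h1,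
    integral_add h4 (integrable_const _), integral_const_mul,
    integral_sub h3 (integrable_const _), integral_id_gaussianReal]
  simp

/-- The usual explicit formula for the divergence between two Gaussian vectors with independent
coordinates and positive variances. -/
lemma kullback_eq (s σ t τ : Fin n → ℝ) (hσ : ∀ i, 0 < σ i) (hτ : ∀ i, 0 < τ i) :
    kullback s σ t τ = ENNReal.ofReal ((1 / 2) * ∑ i, ((s i - t i) ^ 2 / τ i +
      (Real.log (τ i / σ i) + 1 / (τ i / σ i) - 1))) := by
  have hv : ∀ i, (σ i).toNNReal ≠ 0 := fun i => (Real.toNNReal_pos.2 (hσ i)).ne'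
  have hw : ∀ i, (τ i).toNNReal ≠ 0 := fun i => (Real.toNNReal_pos.2 (hτ i)).ne'
  set r : Fin n → ℝ → ℝ := fun i x =>
    gaussianPDFReal (s i) (σ i).toNNReal x / gaussianPDFReal (t i) (τ i).toNNReal x with hr
  have hrm : ∀ i, Measurable (r i) := fun i =>
    (measurable_gaussianPDFReal _ _).div (measurable_gaussianPDFReal _ _)
  have hr0 : ∀ i x, 0 < r i x := fun i x =>
    div_pos (gaussianPDFReal_pos _ _ _ (hv i)) (gaussianPDFReal_pos _ _ _ (hw i))
  have h1 : ∀ i, gaussianReal (s i) (σ i).toNNReal =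
      (gaussianReal (t i) (τ i).toNNReal).withDensity (fun x => ENNReal.ofReal (r i x)) :=
    fun i => gaussianReal_eq_withDensity _ _ (hv i) (hw i)
  have hfm : Measurable fun x : Fin n → ℝ => ∏ i, ENNReal.ofReal (r i (x i)) :=
    Finset.measurable_prod _ fun i _ => ((hrm i).comp (measurable_pi_apply i)).ennreal_ofReal
  have hd : gaussianLaw s σ = (gaussianLaw t τ).withDensity
      (fun x => ∏ i, ENNReal.ofReal (r i (x i))) := by
    have : ∀ i, SigmaFinite ((gaussianReal (t i) (τ i).toNNReal).withDensity
        (fun x => ENNReal.ofReal (r i x))) := fun i => by rw [← h1 i]; infer_instance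
    rw [gaussianLaw, gaussianLaw, ← pi_withDensity _ _ fun i => (hrm i).ennreal_ofReal]
    congr 1
    ext1 i
    exact h1 i
  have : IsProbabilityMeasure (gaussianLaw s σ) := by unfold gaussianLaw; infer_instance
  have : IsProbabilityMeasure (gaussianLaw t τ) := by unfold gaussianLaw; infer_instance
  have hac : gaussianLaw s σ ≪ gaussianLaw t τ := by
    rw [hd]; exact withDensity_absolutelyContinuous _ _
  set g : Fin n → ℝ → ℝ := fun i x => (1 / 2) * Real.log (τ i / σ i) +
    (x - t i) ^ 2 / (2 * τ i) - (x - s i) ^ 2 / (2 * σ i) with hg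
  have hllr : llr (gaussianLaw s σ) (gaussianLaw t τ) =ᵐ[gaussianLaw s σ]
      fun x => ∑ i, g i (x i) := by
    have h2 := hac.ae_le (Measure.rnDeriv_withDensity (gaussianLaw t τ) hfm)
    rw [← hd] at h2
    filter_upwards [h2] with x hx
    rw [llr, hx, ENNReal.toReal_prod, Real.log_prod]
    · refine Finset.sum_congr rfl fun i _ => ?_
      rw [ENNReal.toReal_ofReal (hr0 i _).le, hr, hg]
      simp only
      rw [log_pdf_div _ _ _ (hv i) (hw i), Real.coe_toNNReal _ (hσ i).le,
        Real.coe_toNNReal _ (hτ i).le]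
    · intro i _
      rw [ENNReal.toReal_ofReal (hr0 i _).le]
      exact (hr0 i _).ne'
  have hgi : ∀ i, Integrable (g i) (gaussianReal (s i) (σ i).toNNReal) := fun i =>
    ((integrable_const _).add ((integrable_sub_sq _ _ _).div_const _)).sub
      ((integrable_sub_sq _ _ _).div_const _)
  have hmp : ∀ i, MeasurePreserving (Function.eval i) (gaussianLaw s σ)
      (gaussianReal (s i) (σ i).toNNReal) := fun i => measurePreserving_eval _ i
  have hgi' : ∀ i, Integrable (fun x : Fin n → ℝ => g i (x i)) (gaussianLaw s σ) := fun i =>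
    (hmp i).integrable_comp_of_integrable (hgi i)
  have hint : Integrable (llr (gaussianLaw s σ) (gaussianLaw t τ)) (gaussianLaw s σ) :=
    (integrable_finsetSum _ fun i _ => hgi' i).congr hllr.symm
  rw [kullback, InformationTheory.klDiv_of_ac_of_integrable hac hint]
  congr 1
  rw [integral_congr_ae hllr, integral_finsetSum _ fun i _ => hgi' i]
  simp only [probReal_univ, add_sub_cancel_right]
  rw [Finset.mul_sum]
  refine Finset.sum_congr rfl fun i _ => ?_
  have h3 : ∫ x, g i (x i) ∂(gaussianLaw s σ) = ∫ x, g i x ∂(gaussianReal (s i) (σ i).toNNReal) := by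
    rw [← (hmp i).map_eq, integral_map (hmp i).measurable.aemeasurable]
    rw [(hmp i).map_eq]; exact (hgi i).aestronglyMeasurable
  rw [h3, hg]
  simp only
  have hA : Integrable (fun x => (1 / 2) * Real.log (τ i / σ i) + (x - t i) ^ 2 / (2 * τ i))
      (gaussianReal (s i) (σ i).toNNReal) :=
    (integrable_const _).add ((integrable_sub_sq _ _ _).div_const _)
  rw [integral_sub hA ((integrable_sub_sq _ _ _).div_const _),
    integral_add (integrable_const _) ((integrable_sub_sq _ _ _).div_const _),
    integral_div, integral_div, integral_sub_sq, integral_sub_sq, integral_const,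
    Real.coe_toNNReal _ (hσ i).le]
  have := hσ i
  have := hτ i
  simp only [probReal_univ, smul_eq_mul]
  field_simp
  ring

end KL

/-- The index of a model for vectors of length `n = 2 ^ kn`: an integer `k ≤ kn`, which gives the
regular partition of the coordinates into `2 ^ k` consecutive blocks of length `2 ^ (kn - k)`,
and a nonzero linear subspace `E` of `ℝ^(2 ^ (kn - k))`. -/
structure Model (kn : ℕ) where
  k : ℕ
  k_le : k ≤ kn
  E : Submodule ℝ (EuclideanSpace ℝ (Fin (2 ^ (kn - k))))
  one_le_finrank : 1 ≤ Module.finrank ℝ E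

namespace Model

variable {kn : ℕ} (m : Model kn)

/-- The number `|p_m|` of blocks. -/
def card : ℕ := 2 ^ m.k

/-- The common length `|I| = n / |p_m|` of the blocks. -/
def len : ℕ := 2 ^ (kn - m.k)

/-- The dimension `d_m` of `E_m`. -/
def d : ℕ := Module.finrank ℝ m.E

/-- The dimension `D_m = |p_m| (d_m + 1)` of `S_m × Σ_m`. -/
def D : ℕ := m.card * (m.d + 1)

lemma card_mul_len : m.card * m.len = 2 ^ kn := by
  rw [card, len, ← pow_add, Nat.add_sub_cancel' m.k_le]

/-- The coordinate at position `j` of the block number `b` (both counted from `0`). -/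
def coord (b : Fin m.card) (j : Fin m.len) : Fin (2 ^ kn) :=
  ⟨b * m.len + j, by
    calc (b : ℕ) * m.len + j < b * m.len + m.len := by have := j.2; omega
      _ = (b + 1) * m.len := by ring
      _ ≤ m.card * m.len := Nat.mul_le_mul_right _ b.2
      _ = 2 ^ kn := m.card_mul_len⟩

/-- The block containing the coordinate `i`. -/
def block (i : Fin (2 ^ kn)) : Fin m.card :=
  ⟨i / m.len, by
    rw [Nat.div_lt_iff_lt_mul (by unfold len; positivity), m.card_mul_len]
    exact i.2⟩

/-- The restriction of a vector to the block `b`. -/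
def restrict (b : Fin m.card) (x : Fin (2 ^ kn) → ℝ) :
    EuclideanSpace ℝ (Fin (2 ^ (kn - m.k))) :=
  WithLp.toLp 2 fun j => x (m.coord b j)

/-- The space `S_m` of the vectors whose restriction to every block belongs to `E_m`. -/
def S : Submodule ℝ (EuclideanSpace ℝ (Fin (2 ^ kn))) where
  carrier := {x | ∀ b, m.restrict b x.ofLp ∈ m.E}
  zero_mem' := fun b => by
    have : m.restrict b (0 : EuclideanSpace ℝ (Fin (2 ^ kn))).ofLp = 0 := by
      ext j; simp [restrict]
    rw [this]; exact m.E.zero_mem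
  add_mem' := by
    intro x y hx hy b
    have : m.restrict b (x + y).ofLp = m.restrict b x.ofLp + m.restrict b y.ofLp := by
      ext j; simp [restrict]
    rw [this]; exact m.E.add_mem (hx b) (hy b)
  smul_mem' := by
    intro c x hx b
    have : m.restrict b (c • x).ofLp = c • m.restrict b x.ofLp := by
      ext j; simp [restrict]
    rw [this]; exact m.E.smul_mem c (hx b)

/-- The orthogonal projection `π_m` of `ℝⁿ` onto `S_m`; applied to the first sample, it is the
estimator `ŝ_m` of the mean. -/
def proj (y : Fin (2 ^ kn) → ℝ) : Fin (2 ^ kn) → ℝ :=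
  (m.S.starProjection (WithLp.toLp 2 y)).ofLp

/-- The value on the block `b` of the estimator `σ̂_m` built on the second sample. -/
def blockVar (y : Fin (2 ^ kn) → ℝ) (b : Fin m.card) : ℝ :=
  (1 / (m.len : ℝ)) * ∑ j : Fin m.len, (y (m.coord b j) - m.proj y (m.coord b j)) ^ 2

/-- The estimator `σ̂_m` of the variances, constant on each block. -/
def varEst (y : Fin (2 ^ kn) → ℝ) : Fin (2 ^ kn) → ℝ :=
  fun i => m.blockVar y (m.block i)

/-- The Kullback loss `K(P_{s,σ}, P_{ŝ_m,σ̂_m})` when the samples are `y₁` and `y₂`. -/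
def loss (s σ y₁ y₂ : Fin (2 ^ kn) → ℝ) : ℝ≥0∞ :=
  kullback s σ (m.proj y₁) (m.varEst y₂)

end Model

/-- The likelihood function `L(t, τ)` (up to sign and constants) of the sample `y`. -/
def likelihood {n : ℕ} (y t τ : Fin n → ℝ) : ℝ :=
  (1 / 2) * ∑ i, ((y i - t i) ^ 2 / τ i + Real.log (τ i))

/-- The penalized criterion `Crit(m) = L(ŝ_m, σ̂_m) + pen`. -/
def crit {kn : ℕ} (m : Model kn) (pen : ℝ) (y₁ y₂ : Fin (2 ^ kn) → ℝ) : ℝ :=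
  likelihood y₁ (m.proj y₁) (m.varEst y₂) + pen

/-- The constant `12 √(2e) / (√e - 1)`. -/
def constC : ℝ :=
  12 * Real.sqrt (2 * Real.exp 1) / (Real.sqrt (Real.exp 1) - 1)

/-- The remainder `R₁`, a sum of positive terms with values in `[0, ∞]`. -/
def R₁ {kn : ℕ} {M : Type*} (model : M → Model kn) (x : M → ℝ) (γ θ : ℝ) : ℝ≥0∞ :=
  ENNReal.ofReal (constC * θ ^ 2 * γ) *
    ∑' m, ENNReal.ofReal
      (Real.sqrt ((model m).card : ℝ) * ((model m).d : ℝ) *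
        (2 * constC * θ ^ 2 * γ * Real.sqrt ((model m).card : ℝ) * ((model m).d : ℝ) *
            Real.log (1 + ((model m).d : ℝ)) / x m) ^
          ⌊2 * Real.log (1 + ((model m).d : ℝ))⌋₊)

/-- The remainder `R₂`, a sum of positive terms with values in `[0, ∞]`. -/
def R₂ {kn : ℕ} {M : Type*} (model : M → Model kn) (x : M → ℝ) (γ θ α : ℝ) : ℝ≥0∞ :=
  ENNReal.ofReal ((2 * (α + γ * θ) + 1) / α) *
    ∑' m, ENNReal.ofReal
      (((model m).card : ℝ) *
        Real.exp (-((2 ^ kn : ℝ) / (2 * θ * ((model m).card : ℝ))) *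
          Real.log (1 + α * ((model m).card : ℝ) * x m / (γ * (2 ^ kn : ℝ) * (α + 2)))))


end HeteroGauss

end

open MeasureTheory ProbabilityTheory
open scoped ENNReal

/-! Write `Y₁ = s + e`. For every model, `L(ŝ_m, σ̂_m) - L(s, σ) = K_m - F_m - N_m`
(`likelihood_sub_eq`), where `K_m` is the Kullback loss (`lossReal`), `F_m` is a centred fluctuation
(`fluct`), and `N_m ≥ 0` sums over the blocks the squared norm of the projected noise divided by the
estimated variance (`noise`). Minimality of the criterion at `m̂` gives, for every `m`, `(1 - α)
K_m̂ ≤ K_m + pen(m) - F_m + (F_m̂ + N_m̂ - pen(m̂) - α K_m̂)`. Since `F_m` has mean zero and the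
last bracket is at most the sum of its positive parts over all models, it remains to bound `E(F_m +
N_m - pen(m) - α K_m)₊` by one term of `R₁` plus one term of `R₂` (`lintegral_excess_le`).

Noise. `N_m` is a sum of `|p_m|` independent nonnegative variables. Independence of the two samples
factors their moments into moments of a squared projection and negative moments of a residual sum of
squares. Both come from chi-square type bounds on Laplace transforms, proved by writing
`exp(±u‖Py‖²)` as a Gaussian average of exponentials of linear forms. Hypothesis `(H_θ)` leaves
enough residual degrees of freedom for each variable to have mean at most `γθd` and controlled
moments up to order `⌊2 log(1+d)⌋ + 1`. A moment inequality for sums of independent centred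
variables (`integral_max_sum_pow_le`) then yields the term of `R₁`.

Fluctuations. Given `Y₂`, `F_m` is a sum of independent quadratic polynomials in the `e_i`. If `V ≥
1` dominates every `σ_i/σ̂_i` and `λ = α/V`, then `E exp(λ(F_m - αB_m)) ≤ 1`, where `B_m ≤ K_m`
(`bias`) is the loss without projected noise; this rests on the scalar inequality
`neg_log_one_sub_add_le`. Hence `E(F_m - αB_m - x/4)₊ ≤ (V/α) exp(-αx/(4V))`, and averaging over
`Y₂` with the Laplace bound for the residuals yields the term of `R₂`. -/

namespace HeteroGauss

/-! ### Laplace and Fourier transforms of Gaussian measures. -/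

/-- The Laplace transform of a quadratic polynomial of a centred Gaussian variable. -/
lemma lintegral_exp_quadratic_gaussianReal {v : NNReal} (hv : v ≠ 0) (p q : ℝ)
    (hp : 2 * p * v < 1) :
    ∫⁻ x, ENNReal.ofReal (Real.exp (p * x ^ 2 + q * x)) ∂(gaussianReal 0 v) =
      ENNReal.ofReal (Real.exp (q ^ 2 * v / (2 * (1 - 2 * p * v))) / √(1 - 2 * p * v)) := by
  have hv' : (0 : ℝ) < v := NNReal.coe_pos.2 (pos_iff_ne_zero.2 hv)
  have hr : 0 < 1 - 2 * p * v := by linarith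
  obtain ⟨r, hr', hrr⟩ : ∃ r : ℝ, 0 < r ∧ r = 1 - 2 * p * v := ⟨_, hr, rfl⟩
  -- Completing the square: the tilted density is a multiple of the density of `N(q w, w)` with `w =
  -- v / (1 - 2pv)`.
  obtain ⟨w, hw⟩ : ∃ w : NNReal, (w : ℝ) = v / r := ⟨⟨v / r, by positivity⟩, rfl⟩
  have hw0 : (0 : ℝ) < w := by rw [hw]; positivity
  have hw1 : w ≠ 0 := by rintro rfl; simp at hw0
  rw [gaussianReal_of_var_ne_zero 0 hv,
    lintegral_withDensity_eq_lintegral_mul _ (measurable_gaussianPDF 0 v) (by fun_prop)]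
  have key : ∀ x : ℝ, gaussianPDFReal 0 v x * Real.exp (p * x ^ 2 + q * x) =
      (Real.exp (q ^ 2 * v / (2 * r)) / √r) * gaussianPDFReal (q * w) w x := by
    intro x
    have h1 : √(2 * Real.pi * w) = √(2 * Real.pi * v) / √r := by
      rw [hw, ← Real.sqrt_div (by positivity)]; congr 1; ring
    rw [gaussianPDFReal, gaussianPDFReal, h1, mul_assoc, ← Real.exp_add]
    have h2 : -(x - 0) ^ 2 / (2 * (v : ℝ)) + (p * x ^ 2 + q * x) =
        q ^ 2 * v / (2 * r) + -(x - q * w) ^ 2 / (2 * w) := by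
      rw [hw]
      field_simp
      rw [hrr]
      ring
    rw [h2, Real.exp_add]
    have h3 : 0 < √r := Real.sqrt_pos.2 hr'
    field_simp
  calc _ = ∫⁻ x, ENNReal.ofReal (Real.exp (q ^ 2 * v / (2 * r)) / √r) *
        gaussianPDF (q * w) w x := by
        refine lintegral_congr fun x => ?_
        rw [Pi.mul_apply, gaussianPDF, gaussianPDF, ← ENNReal.ofReal_mul (gaussianPDFReal_nonneg _ _ _),
          key, ENNReal.ofReal_mul (by positivity)]
    _ = _ := by
        rw [lintegral_const_mul _ (measurable_gaussianPDF _ _),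
          lintegral_gaussianPDF_eq_one _ hw1, mul_one, hrr]

/-- Tonelli's theorem for products of functions of one coordinate each. -/
lemma lintegral_pi_prod_eq_prod {ι : Type*} [Fintype ι] (μ : ι → Measure ℝ)
    [∀ i, IsProbabilityMeasure (μ i)] (f : ι → ℝ → ℝ≥0∞) (hf : ∀ i, Measurable (f i)) :
    ∫⁻ x, ∏ i, f i (x i) ∂(Measure.pi μ) = ∏ i, ∫⁻ x, f i x ∂(μ i) := by
  have hind : iIndepFun (fun (i : ι) (x : ι → ℝ) => f i (x i)) (Measure.pi μ) :=
    iIndepFun_pi fun i => (hf i).aemeasurable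
  rw [lintegral_prod_eq_prod_lintegral_of_indepFun Finset.univ _ hind
    (fun i => (hf i).comp (measurable_pi_apply i))]
  exact Finset.prod_congr rfl fun i _ => (measurePreserving_eval μ i).lintegral_comp (hf i)

/-- The Laplace transform of a chi-square variable with `d` degrees of freedom. -/
lemma lintegral_exp_mul_sum_sq (d : ℕ) {t : ℝ} (ht : 2 * t < 1) :
    ∫⁻ g, ENNReal.ofReal (Real.exp (t * ∑ k, g k ^ 2))
      ∂(gaussianLaw (0 : Fin d → ℝ) 1) =
      ENNReal.ofReal ((1 - 2 * t) ^ (-(d : ℝ) / 2)) := by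
  have h1 : ∀ g : Fin d → ℝ, ENNReal.ofReal (Real.exp (t * ∑ k, g k ^ 2)) =
      ∏ k, ENNReal.ofReal (Real.exp (t * g k ^ 2)) := by
    intro g
    rw [Finset.mul_sum, Real.exp_sum, ENNReal.ofReal_prod_of_nonneg fun _ _ => (Real.exp_pos _).le]
  simp_rw [h1, gaussianLaw, Pi.zero_apply, Pi.one_apply, Real.toNNReal_one]
  rw [lintegral_pi_prod_eq_prod _ (fun _ x => ENNReal.ofReal (Real.exp (t * x ^ 2)))
    (fun _ => by fun_prop)]
  have h2 := lintegral_exp_quadratic_gaussianReal (v := 1) one_ne_zero t 0 (by simpa using ht)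
  simp only [zero_mul, add_zero, NNReal.coe_one, mul_one] at h2
  rw [h2, Finset.prod_const, Finset.card_univ, Fintype.card_fin, ← ENNReal.ofReal_pow (by positivity)]
  congr 1
  have h3 : 0 < 1 - 2 * t := by linarith
  norm_num
  rw [Real.sqrt_eq_rpow, ← Real.rpow_natCast, ← Real.rpow_mul h3.le, ← Real.rpow_neg h3.le]
  congr 1; ring

/-- The Laplace transform of a linear form of a centred Gaussian vector. -/
lemma lintegral_exp_linear_gaussianLaw {n : ℕ} (σ : Fin n → ℝ) (hσ : ∀ i, 0 < σ i)
    (c : Fin n → ℝ) :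
    ∫⁻ y, ENNReal.ofReal (Real.exp (∑ i, c i * y i)) ∂(gaussianLaw 0 σ) =
      ENNReal.ofReal (Real.exp (∑ i, σ i * c i ^ 2 / 2)) := by
  have h1 : ∀ y : Fin n → ℝ, ENNReal.ofReal (Real.exp (∑ i, c i * y i)) =
      ∏ i, ENNReal.ofReal (Real.exp (c i * y i)) := by
    intro g
    rw [Real.exp_sum, ENNReal.ofReal_prod_of_nonneg fun _ _ => (Real.exp_pos _).le]
  simp_rw [h1, gaussianLaw]
  rw [lintegral_pi_prod_eq_prod _ (fun i x => ENNReal.ofReal (Real.exp (c i * x)))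
    (fun _ => by fun_prop), Real.exp_sum, ENNReal.ofReal_prod_of_nonneg fun _ _ => (Real.exp_pos _).le]
  refine Finset.prod_congr rfl fun i _ => ?_
  have h2 := lintegral_exp_quadratic_gaussianReal (Real.toNNReal_pos.2 (hσ i)).ne' 0 (c i)
    (by simp)
  simp only [zero_mul, zero_add, mul_zero, sub_zero, Real.sqrt_one, div_one, mul_one,
    Real.coe_toNNReal _ (hσ i).le, Pi.zero_apply] at h2 ⊢
  rw [h2]
  congr 2; ring

/-- The characteristic function of a Gaussian vector with independent coordinates. -/
lemma integral_cexp_linear_gaussianLaw {n : ℕ} (s σ : Fin n → ℝ) (hσ : ∀ i, 0 < σ i)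
    (c : Fin n → ℝ) :
    ∫ y, Complex.exp (((∑ i, c i * y i : ℝ) : ℂ) * Complex.I) ∂(gaussianLaw s σ) =
      Complex.exp (((-∑ i, σ i * c i ^ 2 / 2 : ℝ) : ℂ) +
        ((∑ i, c i * s i : ℝ) : ℂ) * Complex.I) := by
  have h1 : ∀ y : Fin n → ℝ, Complex.exp (((∑ i, c i * y i : ℝ) : ℂ) * Complex.I) =
      ∏ i, Complex.exp ((c i : ℂ) * y i * Complex.I) := by
    intro g
    rw [← Complex.exp_sum]; push_cast; rw [Finset.sum_mul]
  simp_rw [h1, gaussianLaw]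
  rw [integral_fintype_prod_eq_prod (f := fun i (x : ℝ) => Complex.exp ((c i : ℂ) * x * Complex.I))]
  push_cast
  rw [← Finset.sum_neg_distrib, Finset.sum_mul, ← Finset.sum_add_distrib, Complex.exp_sum]
  refine Finset.prod_congr rfl fun i _ => ?_
  have h2 := charFun_gaussianReal (μ := s i) (v := (σ i).toNNReal) (c i)
  rw [charFun_apply_real] at h2
  rw [h2]
  congr 1
  have : ((σ i).toNNReal : ℂ) = ((σ i : ℝ) : ℂ) := by
    rw [← Real.coe_toNNReal _ (hσ i).le]; simp
  rw [this]
  ring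

/-- The modulus of the characteristic function of a Gaussian vector. -/
lemma norm_integral_cexp_linear_gaussianLaw {n : ℕ} (s σ : Fin n → ℝ) (hσ : ∀ i, 0 < σ i)
    (c : Fin n → ℝ) :
    ‖∫ y, Complex.exp (((∑ i, c i * y i : ℝ) : ℂ) * Complex.I) ∂(gaussianLaw s σ)‖ =
      Real.exp (-∑ i, σ i * c i ^ 2 / 2) := by
  rw [integral_cexp_linear_gaussianLaw s σ hσ, Complex.norm_exp, Complex.add_re,
    Complex.ofReal_re, Complex.re_ofReal_mul, Complex.I_re, mul_zero, add_zero]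

instance {n : ℕ} (t τ : Fin n → ℝ) : IsProbabilityMeasure (gaussianLaw t τ) := by
  unfold gaussianLaw; infer_instance

/-! ### Laplace transforms of squared projections. -/

section Projection

variable {n : ℕ} (F : Submodule ℝ (EuclideanSpace ℝ (Fin n)))

/-- The squared norm of the orthogonal projection of `y` onto `F`. -/
noncomputable def projSq (y : Fin n → ℝ) : ℝ := ‖F.starProjection (WithLp.toLp 2 y)‖ ^ 2

lemma projSq_nonneg (y : Fin n → ℝ) : 0 ≤ projSq F y := sq_nonneg _

@[fun_prop]
lemma continuous_projSq : Continuous (projSq F) := by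
  unfold projSq
  have : Continuous fun y : Fin n → ℝ => WithLp.toLp 2 y := PiLp.continuous_toLp 2 _
  fun_prop

@[fun_prop]
lemma measurable_projSq : Measurable (projSq F) := (continuous_projSq F).measurable

/-- The vector of `F` with given coordinates in an orthonormal basis of `F`. -/
noncomputable def synth (g : Fin (Module.finrank ℝ F) → ℝ) : Fin n → ℝ :=
  ((∑ k, g k • stdOrthonormalBasis ℝ F k : F) : EuclideanSpace ℝ (Fin n)).ofLp

lemma synth_apply (g : Fin (Module.finrank ℝ F) → ℝ) (i : Fin n) :
    synth F g i = ∑ k, g k * (stdOrthonormalBasis ℝ F k : EuclideanSpace ℝ (Fin n)) i := by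
  simp [synth]

lemma sum_sq_synth (g : Fin (Module.finrank ℝ F) → ℝ) :
    ∑ i, synth F g i ^ 2 = ∑ k, g k ^ 2 := by
  have h1 : ∑ i, synth F g i ^ 2 = ‖(∑ k, g k • stdOrthonormalBasis ℝ F k : F)‖ ^ 2 := by
    rw [Submodule.coe_norm, EuclideanSpace.norm_sq_eq]
    simp [synth]
  rw [h1, ← (stdOrthonormalBasis ℝ F).repr.norm_map, EuclideanSpace.norm_sq_eq]
  refine Finset.sum_congr rfl fun k _ => ?_
  simp [map_sum, Pi.single_apply]

/-- The coordinates of the projection of `y` in the orthonormal basis of `F`. -/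
noncomputable def projCoeff (y : Fin n → ℝ) (k : Fin (Module.finrank ℝ F)) : ℝ :=
  ∑ i, (stdOrthonormalBasis ℝ F k : EuclideanSpace ℝ (Fin n)) i * y i

lemma projCoeff_eq_inner (y : Fin n → ℝ) (k : Fin (Module.finrank ℝ F)) :
    projCoeff F y k = inner ℝ (stdOrthonormalBasis ℝ F k) (F.orthogonalProjectionOnto (WithLp.toLp 2 y)) := by
  rw [Submodule.inner_orthogonalProjectionOnto_eq_of_mem_left, PiLp.inner_apply]
  simp [projCoeff, mul_comm]

lemma sum_sq_projCoeff (y : Fin n → ℝ) : ∑ k, projCoeff F y k ^ 2 = projSq F y := by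
  simp_rw [projCoeff_eq_inner]
  have := (stdOrthonormalBasis ℝ F).sum_sq_norm_inner_right
    (F.orthogonalProjectionOnto (WithLp.toLp 2 y))
  simp only [Real.norm_eq_abs, sq_abs] at this
  rw [this, projSq, Submodule.starProjection_apply, Submodule.coe_norm]

/-- Synthesis is adjoint to taking coefficients. It turns a linear form in an auxiliary Gaussian `g`
into one in the independent coordinates of `y`. -/
lemma sum_synth_mul (g : Fin (Module.finrank ℝ F) → ℝ) (y : Fin n → ℝ) :
    ∑ i, synth F g i * y i = ∑ k, g k * projCoeff F y k := by
  simp_rw [synth_apply, projCoeff, Finset.sum_mul, Finset.mul_sum]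
  rw [Finset.sum_comm]
  simp_rw [mul_assoc]

/-- An upper bound on the exponential moments of the squared norm of the projection of a centred
Gaussian vector. -/
lemma lintegral_exp_mul_projSq_le (σ : Fin n → ℝ) (hσ : ∀ i, 0 < σ i) {σ₁ : ℝ}
    (hσ₁ : ∀ i, σ i ≤ σ₁) {t : ℝ} (ht : 0 ≤ t) (ht1 : 2 * (t * σ₁) < 1) :
    ∫⁻ y, ENNReal.ofReal (Real.exp (t * projSq F y)) ∂(gaussianLaw 0 σ) ≤
      ENNReal.ofReal ((1 - 2 * (t * σ₁)) ^ (-(Module.finrank ℝ F : ℝ) / 2)) := by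
  -- Gaussian linearisation: the exponential of a square is the average over a standard Gaussian `g`
  -- of exponentials of linear forms.
  have h1 : ∀ y : Fin n → ℝ, ENNReal.ofReal (Real.exp (t * projSq F y)) =
      ∫⁻ g, ENNReal.ofReal (Real.exp (∑ k, (√(2 * t) * projCoeff F y k) * g k))
        ∂(gaussianLaw (0 : Fin (Module.finrank ℝ F) → ℝ) 1) := by
    intro y
    rw [lintegral_exp_linear_gaussianLaw 1 (fun _ => one_pos), ← sum_sq_projCoeff, Finset.mul_sum]
    congr 3 with k
    rw [mul_pow, Real.sq_sqrt (by positivity), Pi.one_apply]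
    ring
  have hm : ∀ k, Measurable fun y : Fin n → ℝ => projCoeff F y k := fun k => by
    unfold projCoeff; fun_prop
  simp_rw [h1]
  rw [lintegral_lintegral_swap]
  swap
  · refine Measurable.aemeasurable ?_
    unfold Function.uncurry
    have : ∀ k, Measurable fun p : (Fin n → ℝ) × (Fin (Module.finrank ℝ F) → ℝ) =>
      projCoeff F p.1 k := fun k => (hm k).comp measurable_fst
    fun_prop
  rw [← lintegral_exp_mul_sum_sq _ ht1]
  refine lintegral_mono fun g => ?_
  have h2 : ∀ y : Fin n → ℝ, ∑ k, (√(2 * t) * projCoeff F y k) * g k =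
      ∑ i, (√(2 * t) * synth F g i) * y i := by
    intro y
    simp_rw [mul_assoc, ← Finset.mul_sum]
    rw [sum_synth_mul]
    simp_rw [mul_comm]
  simp_rw [h2]
  rw [lintegral_exp_linear_gaussianLaw _ hσ]
  refine ENNReal.ofReal_le_ofReal (Real.exp_le_exp.2 ?_)
  -- As `synth` is isometric, bounding each variance by `σ₁` leaves the chi-square exponent
  -- `tσ₁‖g‖²`.
  rw [← sum_sq_synth, Finset.mul_sum]
  refine Finset.sum_le_sum fun i _ => ?_
  rw [mul_pow, Real.sq_sqrt (by positivity)]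
  nlinarith [mul_le_mul_of_nonneg_right (hσ₁ i) (mul_nonneg ht (sq_nonneg (synth F g i)))]

/-- An upper bound on the Laplace transform of the squared norm of the projection of a Gaussian
vector. -/
lemma lintegral_exp_neg_mul_projSq_le (s σ : Fin n → ℝ) (hσ : ∀ i, 0 < σ i) {σ₀ : ℝ}
    (hσ₀0 : 0 < σ₀) (hσ₀ : ∀ i, σ₀ ≤ σ i) {u : ℝ} (hu : 0 ≤ u) :
    ∫⁻ y, ENNReal.ofReal (Real.exp (-(u * projSq F y))) ∂(gaussianLaw s σ) ≤
      ENNReal.ofReal ((1 + 2 * (u * σ₀)) ^ (-(Module.finrank ℝ F : ℝ) / 2)) := by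
  set G := gaussianLaw (0 : Fin (Module.finrank ℝ F) → ℝ) 1
  -- The same linearisation with imaginary linear forms, the sign of the square being negative.
  have h1 : ∀ y : Fin n → ℝ, ((Real.exp (-(u * projSq F y)) : ℝ) : ℂ) =
      ∫ g, Complex.exp (((∑ k, (√(2 * u) * projCoeff F y k) * g k : ℝ) : ℂ) * Complex.I) ∂G := by
    intro y
    rw [integral_cexp_linear_gaussianLaw 0 1 (fun _ => one_pos), ← sum_sq_projCoeff, Finset.mul_sum]
    simp only [Pi.zero_apply, mul_zero, Finset.sum_const_zero, Complex.ofReal_zero, zero_mul,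
      add_zero, Complex.ofReal_exp]
    congr 4 with k
    rw [mul_pow, Real.sq_sqrt (by positivity), Pi.one_apply]
    ring
  have hm : ∀ k, Measurable fun y : Fin n → ℝ => projCoeff F y k := fun k => by
    unfold projCoeff; fun_prop
  have hint : Integrable (fun y => Real.exp (-(u * projSq F y))) (gaussianLaw s σ) := by
    refine Integrable.of_bound (C := 1) (by fun_prop) (Filter.Eventually.of_forall fun y => ?_)
    rw [Real.norm_eq_abs, Real.abs_exp]
    exact Real.exp_le_one_iff.2 (by have := mul_nonneg hu (projSq_nonneg F y); linarith)
  rw [← ofReal_integral_eq_lintegral_ofReal hint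
    (Filter.Eventually.of_forall fun y => (Real.exp_pos _).le)]
  refine ENNReal.ofReal_le_ofReal ?_
  have h3 : ∫ y, Real.exp (-(u * projSq F y)) ∂(gaussianLaw s σ) =
      ‖∫ y, ((Real.exp (-(u * projSq F y)) : ℝ) : ℂ) ∂(gaussianLaw s σ)‖ := by
    rw [integral_complex_ofReal, Complex.norm_real, Real.norm_of_nonneg]
    exact integral_nonneg fun y => (Real.exp_pos _).le
  rw [h3]
  simp_rw [h1]
  rw [integral_integral_swap]
  swap
  · refine Integrable.of_bound (C := 1) ?_ (Filter.Eventually.of_forall fun y => ?_)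
    · refine Measurable.aestronglyMeasurable ?_
      unfold Function.uncurry
      have : ∀ k, Measurable fun p : (Fin n → ℝ) × (Fin (Module.finrank ℝ F) → ℝ) =>
        projCoeff F p.1 k := fun k => (hm k).comp measurable_fst
      fun_prop
    · rw [Function.uncurry, Complex.norm_exp_ofReal_mul_I]
  have h2 : ∀ (y : Fin n → ℝ) (g : Fin (Module.finrank ℝ F) → ℝ),
      ∑ k, (√(2 * u) * projCoeff F y k) * g k = ∑ i, (√(2 * u) * synth F g i) * y i := by
    intro y g
    simp_rw [mul_assoc, ← Finset.mul_sum]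
    rw [sum_synth_mul]
    simp_rw [mul_comm]
  simp_rw [h2]
  -- The mean `s` enters only through a phase, so taking moduli gives a bound uniform in `s`.
  refine (norm_integral_le_integral_norm _).trans ?_
  simp_rw [norm_integral_cexp_linear_gaussianLaw s σ hσ]
  have h4 := lintegral_exp_mul_sum_sq (Module.finrank ℝ F) (t := -(u * σ₀))
    (by have := mul_nonneg hu hσ₀0.le; linarith)
  have hint2 : Integrable (fun g => Real.exp (-(u * σ₀) * ∑ k, g k ^ 2)) G := by
    refine Integrable.of_bound (C := 1)
      (Continuous.aestronglyMeasurable (by fun_prop)) (Filter.Eventually.of_forall fun y => ?_)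
    rw [Real.norm_eq_abs, Real.abs_exp]
    refine Real.exp_le_one_iff.2 ?_
    have : 0 ≤ ∑ k, y k ^ 2 := Finset.sum_nonneg fun _ _ => sq_nonneg _
    have := mul_nonneg (mul_nonneg hu hσ₀0.le) this
    linarith
  rw [← ofReal_integral_eq_lintegral_ofReal hint2
    (Filter.Eventually.of_forall fun y => (Real.exp_pos _).le)] at h4
  have h5 : (0 : ℝ) ≤ (1 - 2 * -(u * σ₀)) := by have := mul_nonneg hu hσ₀0.le; linarith
  rw [ENNReal.ofReal_eq_ofReal_iff (integral_nonneg fun y => (Real.exp_pos _).le)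
    (by positivity)] at h4
  rw [show 1 + 2 * (u * σ₀) = 1 - 2 * -(u * σ₀) by ring, ← h4]
  refine integral_mono_of_nonneg (Filter.Eventually.of_forall fun y => (Real.exp_pos _).le) hint2
    (Filter.Eventually.of_forall fun g => Real.exp_le_exp.2 ?_)
  rw [← sum_sq_synth, neg_mul, neg_le_neg_iff, Finset.mul_sum]
  refine Finset.sum_le_sum fun i _ => ?_
  rw [mul_pow, Real.sq_sqrt (by positivity)]
  nlinarith [mul_le_mul_of_nonneg_right (hσ₀ i) (mul_nonneg hu (sq_nonneg (synth F g i)))]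

end Projection

/-! ### Integrals over half-lines. -/

/-- The integral over `(c, ∞)` of minus the derivative of a nonincreasing function vanishing at
infinity. -/
lemma lintegral_Ioi_of_hasDerivAt {f g : ℝ → ℝ} {c : ℝ}
    (hf : ∀ u ∈ Set.Ici c, HasDerivAt f (-g u) u) (hg : ∀ u ∈ Set.Ioi c, 0 ≤ g u)
    (hlim : Filter.Tendsto f Filter.atTop (nhds 0)) :
    ∫⁻ u in Set.Ioi c, ENNReal.ofReal (g u) = ENNReal.ofReal (f c) := by
  have hneg : ∀ u ∈ Set.Ioi c, -g u ≤ 0 := fun u hu => neg_nonpos.2 (hg u hu)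
  have h1 := integral_Ioi_of_hasDerivAt_of_nonpos' hf hneg hlim
  have h2 : IntegrableOn g (Set.Ioi c) := by
    have := (integrableOn_Ioi_deriv_of_nonpos' hf hneg hlim).neg
    simpa using this
  rw [← ofReal_integral_eq_lintegral_ofReal h2
    ((ae_restrict_iff' measurableSet_Ioi).2 (Filter.Eventually.of_forall hg))]
  congr 1
  rw [integral_neg] at h1
  linarith

lemma lintegral_Ioi_exp_neg_mul {w : ℝ} (hw : 0 < w) (c : ℝ) :
    ∫⁻ u in Set.Ioi c, ENNReal.ofReal (Real.exp (-(u * w))) =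
      ENNReal.ofReal (w⁻¹ * Real.exp (-(c * w))) := by
  refine lintegral_Ioi_of_hasDerivAt (f := fun u => w⁻¹ * Real.exp (-(u * w))) (fun u _ => ?_)
    (fun u _ => (Real.exp_pos _).le) ?_
  · have h := ((((hasDerivAt_id u).mul_const w).neg).exp).const_mul w⁻¹
    refine h.congr_deriv ?_
    simp only [id, Pi.neg_apply]
    field_simp
  · have h : Filter.Tendsto (fun u : ℝ => -(u * w)) Filter.atTop Filter.atBot :=
      Filter.tendsto_neg_atTop_atBot.comp (Filter.tendsto_id.atTop_mul_const hw)
    simpa using (Real.tendsto_exp_atBot.comp h).const_mul w⁻¹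

lemma lintegral_Ioi_one_add_rpow {σ a c : ℝ} (hσ : 0 < σ) (ha : 1 < a) (hc : 0 ≤ c) :
    ∫⁻ u in Set.Ioi c, ENNReal.ofReal ((1 + 2 * (u * σ)) ^ (-a)) =
      ENNReal.ofReal ((1 + 2 * (c * σ)) ^ (-(a - 1)) / (2 * σ * (a - 1))) := by
  have hpos : ∀ u, c ≤ u → 0 < 1 + 2 * (u * σ) := fun u hu => by
    have := mul_nonneg (hc.trans hu) hσ.le; linarith
  refine lintegral_Ioi_of_hasDerivAt
    (f := fun u => (1 + 2 * (u * σ)) ^ (-(a - 1)) / (2 * σ * (a - 1))) (fun u hu => ?_)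
    (fun u hu => Real.rpow_nonneg (hpos u (le_of_lt hu)).le _) ?_
  · have h0 : HasDerivAt (fun u : ℝ => 1 + 2 * (u * σ)) (2 * (1 * σ)) u :=
      (((hasDerivAt_id u).mul_const σ).const_mul 2).const_add 1
    have h := (h0.rpow_const (p := -(a - 1)) (Or.inl (hpos u hu).ne')).div_const (2 * σ * (a - 1))
    refine h.congr_deriv ?_
    have : (0 : ℝ) < a - 1 := by linarith
    rw [show -(a - 1) - 1 = -a by ring]
    field_simp
  · have h : Filter.Tendsto (fun u : ℝ => 1 + 2 * (u * σ)) Filter.atTop Filter.atTop :=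
      Filter.tendsto_atTop_add_const_left _ _
        ((Filter.tendsto_id.atTop_mul_const hσ).const_mul_atTop two_pos)
    simpa using ((tendsto_rpow_neg_atTop (by linarith : 0 < a - 1)).comp h).div_const
      (2 * σ * (a - 1))

/-! ### Moments deduced from Laplace transforms. -/

section Moments

variable {Ω : Type*} [MeasurableSpace Ω] {μ : Measure Ω} {W : Ω → ℝ}

/-- Negative moments of a nonnegative variable, deduced from a bound on its Laplace transform. -/
lemma lintegral_inv_pow_mul_exp_le [SFinite μ] (hW : Measurable W) (hW0 : ∀ ω, 0 ≤ W ω) {σ ν : ℝ}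
    (hσ : 0 < σ)
    (hL : ∀ u, 0 ≤ u → ∫⁻ ω, ENNReal.ofReal (Real.exp (-(u * W ω))) ∂μ ≤
      ENNReal.ofReal ((1 + 2 * (u * σ)) ^ (-ν)))
    (q : ℕ) (hq : q < ν) (i : ℕ) (hi : i ≤ q) (c : ℝ) (hc : 0 ≤ c) :
    ∫⁻ ω, ENNReal.ofReal ((W ω)⁻¹ ^ i * Real.exp (-(c * W ω))) ∂μ ≤
      ENNReal.ofReal ((1 + 2 * (c * σ)) ^ (-(ν - i)) * ((2 * σ * (ν - q))⁻¹) ^ i) := by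
  induction i generalizing c with
  | zero => simpa using hL c hc
  | succ i ih =>
    have hiq : (i : ℝ) + 1 ≤ q := by exact_mod_cast hi
    have hνq : 0 < ν - q := by linarith
    -- For `W > 0` this is the equality `W⁻¹ exp(-cW) = ∫_c^∞ exp(-uW) du`. For `W = 0` the left
    -- side vanishes by the convention `0⁻¹ = 0`, so only an inequality holds.
    have h1 : ∀ ω, ENNReal.ofReal ((W ω)⁻¹ ^ (i + 1) * Real.exp (-(c * W ω))) ≤
        ∫⁻ u in Set.Ioi c, ENNReal.ofReal ((W ω)⁻¹ ^ i * Real.exp (-(u * W ω))) := by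
      intro ω
      rcases (hW0 ω).eq_or_lt with h | h
      · rw [← h]; simp
      · have h0 : 0 ≤ (W ω)⁻¹ ^ i := by positivity
        simp_rw [ENNReal.ofReal_mul h0]
        rw [lintegral_const_mul _ (by fun_prop), lintegral_Ioi_exp_neg_mul h,
          ← ENNReal.ofReal_mul h0]
        refine ENNReal.ofReal_le_ofReal (le_of_eq ?_)
        ring
    calc _ ≤ ∫⁻ ω, (∫⁻ u in Set.Ioi c, ENNReal.ofReal ((W ω)⁻¹ ^ i * Real.exp (-(u * W ω)))) ∂μ :=
          lintegral_mono h1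
      _ = ∫⁻ u in Set.Ioi c, ∫⁻ ω, ENNReal.ofReal ((W ω)⁻¹ ^ i * Real.exp (-(u * W ω))) ∂μ := by
          refine lintegral_lintegral_swap (Measurable.aemeasurable ?_)
          unfold Function.uncurry
          have : Measurable fun p : Ω × ℝ => W p.1 := hW.comp measurable_fst
          fun_prop
      _ ≤ ∫⁻ u in Set.Ioi c, ENNReal.ofReal (((2 * σ * (ν - q))⁻¹) ^ i) *
            ENNReal.ofReal ((1 + 2 * (u * σ)) ^ (-(ν - i))) := by
          refine setLIntegral_mono' measurableSet_Ioi fun u hu => ?_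
          have := ih (by omega) u (hc.trans (le_of_lt hu))
          rwa [mul_comm, ENNReal.ofReal_mul (by positivity)] at this
      _ = ENNReal.ofReal (((2 * σ * (ν - q))⁻¹) ^ i) * ENNReal.ofReal
            ((1 + 2 * (c * σ)) ^ (-(ν - i - 1)) / (2 * σ * (ν - i - 1))) := by
          rw [lintegral_const_mul _ (by fun_prop),
            lintegral_Ioi_one_add_rpow hσ (by linarith) hc]
      _ ≤ _ := by
          rw [← ENNReal.ofReal_mul (by positivity)]
          refine ENNReal.ofReal_le_ofReal ?_
          have h2 : 0 ≤ (1 + 2 * (c * σ)) ^ (-(ν - i - 1)) :=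
            Real.rpow_nonneg (by positivity) _
          rw [pow_succ, show ν - ((i + 1 : ℕ) : ℝ) = ν - i - 1 by push_cast; ring,
            div_eq_mul_inv]
          -- Since `i + 1 ≤ q`, every step of the recursion can be charged the same factor, so that
          -- a pure power remains.
          have h3 : (2 * σ * (ν - i - 1))⁻¹ ≤ (2 * σ * (ν - q))⁻¹ := by
            refine inv_anti₀ (by positivity) ?_
            exact mul_le_mul_of_nonneg_left (by linarith) (by positivity)
          calc _ = (1 + 2 * (c * σ)) ^ (-(ν - i - 1)) * ((2 * σ * (ν - q))⁻¹ ^ i *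
                (2 * σ * (ν - i - 1))⁻¹) := by ring
            _ ≤ _ := by gcongr

/-- Positivity of a nonnegative variable, deduced from a bound on its Laplace transform. -/
lemma ae_pos_of_laplace (hW : Measurable W) (hW0 : ∀ ω, 0 ≤ W ω) {σ ν : ℝ}
    (hσ : 0 < σ) (hν : 0 < ν)
    (hL : ∀ u, 0 ≤ u → ∫⁻ ω, ENNReal.ofReal (Real.exp (-(u * W ω))) ∂μ ≤
      ENNReal.ofReal ((1 + 2 * (u * σ)) ^ (-ν))) :
    ∀ᵐ ω ∂μ, 0 < W ω := by
  have hms : MeasurableSet {ω | W ω = 0} := hW (measurableSet_singleton 0)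
  -- On `{W = 0}` the exponential equals one; letting `u → ∞` gives the claim.
  have h1 : ∀ u : ℝ, 0 ≤ u → μ {ω | W ω = 0} ≤ ENNReal.ofReal ((1 + 2 * (u * σ)) ^ (-ν)) := by
    intro u hu
    refine le_trans ?_ (hL u hu)
    rw [← lintegral_indicator_one hms]
    refine lintegral_mono fun ω => ?_
    by_cases h : W ω = 0
    · simp [h]
    · simp [Set.indicator, h]
  have h : Filter.Tendsto (fun u : ℝ => 1 + 2 * (u * σ)) Filter.atTop Filter.atTop :=
    Filter.tendsto_atTop_add_const_left _ _
      ((Filter.tendsto_id.atTop_mul_const hσ).const_mul_atTop two_pos)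
  have h2 := ENNReal.tendsto_ofReal ((tendsto_rpow_neg_atTop hν).comp h)
  have h3 : μ {ω | W ω = 0} ≤ ENNReal.ofReal 0 :=
    ge_of_tendsto h2 ((Filter.eventually_ge_atTop 0).mono h1)
  rw [ENNReal.ofReal_zero, nonpos_iff_eq_zero] at h3
  refine measure_mono_null (fun ω hω => ?_) h3
  exact le_antisymm (not_lt.1 hω) (hW0 ω)

/-- Positive moments of a nonnegative variable, deduced from a bound on its Laplace transform. -/
lemma lintegral_pow_le (hW0 : ∀ ω, 0 ≤ W ω) {σ d : ℝ} (hσ : 0 < σ) (hd : 0 < d)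
    (hL : ∀ t, 0 ≤ t → 2 * (t * σ) < 1 → ∫⁻ ω, ENNReal.ofReal (Real.exp (t * W ω)) ∂μ ≤
      ENNReal.ofReal ((1 - 2 * (t * σ)) ^ (-d / 2))) (i : ℕ) (hi : 1 ≤ i) :
    ∫⁻ ω, ENNReal.ofReal (W ω ^ i) ∂μ ≤ ENNReal.ofReal ((σ * (d + 2 * i)) ^ i) := by
  have hi' : (0 : ℝ) < i := by exact_mod_cast hi
  -- This choice gives `1 - 2tσ = d/(d + 2i)`. Raising `z ≤ exp(z - 1)`, `z = tW/i`, to the power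
  -- `i` produces a factor `exp(-i)`, which compensates `((d + 2i)/d)^(d/2) ≤ exp i`.
  set t : ℝ := i / (σ * (d + 2 * i)) with ht
  have htpos : 0 < t := by positivity
  have hr : 1 - 2 * (t * σ) = d / (d + 2 * i) := by rw [ht]; field_simp; ring
  have hr0 : 0 < d / (d + 2 * i) := by positivity
  have h1 : ∀ ω, W ω ^ i ≤ (σ * (d + 2 * i)) ^ i * Real.exp (-i) * Real.exp (t * W ω) := by
    intro ω
    have h2 : t * W ω / i ≤ Real.exp (t * W ω / i - 1) := by
      have := Real.add_one_le_exp (t * W ω / i - 1); linarith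
    have h3 := pow_le_pow_left₀ (by have := hW0 ω; positivity) h2 i
    rw [← Real.exp_nat_mul, show (i : ℝ) * (t * W ω / i - 1) = -i + t * W ω by field_simp; ring,
      Real.exp_add] at h3
    have h4 : W ω ^ i = (σ * (d + 2 * i)) ^ i * (t * W ω / i) ^ i := by
      rw [← mul_pow]; congr 1; rw [ht]; field_simp
    rw [h4, mul_assoc]
    gcongr
  calc _ ≤ ∫⁻ ω, ENNReal.ofReal ((σ * (d + 2 * i)) ^ i * Real.exp (-i)) *
        ENNReal.ofReal (Real.exp (t * W ω)) ∂μ := by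
        refine lintegral_mono fun ω => ?_
        rw [← ENNReal.ofReal_mul (by positivity)]
        exact ENNReal.ofReal_le_ofReal (h1 ω)
    _ = ENNReal.ofReal ((σ * (d + 2 * i)) ^ i * Real.exp (-i)) *
        ∫⁻ ω, ENNReal.ofReal (Real.exp (t * W ω)) ∂μ := lintegral_const_mul' _ _ (by simp)
    _ ≤ ENNReal.ofReal ((σ * (d + 2 * i)) ^ i * Real.exp (-i)) *
        ENNReal.ofReal ((1 - 2 * (t * σ)) ^ (-d / 2)) := by
        gcongr
        exact hL t htpos.le (by linarith)
    _ ≤ _ := by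
        rw [← ENNReal.ofReal_mul (by positivity)]
        refine ENNReal.ofReal_le_ofReal ?_
        rw [hr, mul_assoc]
        refine mul_le_of_le_one_right (by positivity) ?_
        have h5 : (d / (d + 2 * i)) ^ (-d / 2) ≤ Real.exp i := by
          rw [neg_div, Real.rpow_neg hr0.le, ← Real.inv_rpow hr0.le, inv_div]
          have : (d + 2 * i) / d ≤ Real.exp (2 * i / d) := by
            have := Real.add_one_le_exp (2 * i / d)
            have h6 : (d + 2 * i) / d = 2 * i / d + 1 := by field_simp; ring
            linarith
          calc _ ≤ (Real.exp (2 * i / d)) ^ (d / 2) :=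
                Real.rpow_le_rpow (by positivity) this (by positivity)
            _ = _ := by rw [← Real.exp_mul]; congr 1; field_simp
        calc _ ≤ Real.exp (-i) * Real.exp i := by gcongr
          _ = 1 := by rw [← Real.exp_add]; simp

end Moments

/-! ### The mean of a squared projection. -/

section Projection

variable {n : ℕ} (F : Submodule ℝ (EuclideanSpace ℝ (Fin n)))

/-- The exact second moment is needed because the penalty allows only `d + 1` per block:
`lintegral_pow_le` at order one would give `d + 2` where the mean is at most `σ₁ d`. -/
lemma integral_linear_sq_gaussianLaw (σ : Fin n → ℝ) (hσ : ∀ i, 0 < σ i) (c : Fin n → ℝ) :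
    Integrable (fun y => (∑ i, c i * y i) ^ 2) (gaussianLaw 0 σ) ∧
    ∫ y, (∑ i, c i * y i) ^ 2 ∂(gaussianLaw 0 σ) = ∑ i, σ i * c i ^ 2 := by
  have hmem : ∀ i, MemLp (fun x : ℝ => c i * x) 2 (gaussianReal 0 (σ i).toNNReal) := fun i =>
    (memLp_id_gaussianReal 2).const_mul _
  have hmp : ∀ i, MeasurePreserving (Function.eval i) (gaussianLaw 0 σ)
      (gaussianReal 0 (σ i).toNNReal) := fun i => measurePreserving_eval _ i
  have hmem' : ∀ i, MemLp (fun y : Fin n → ℝ => c i * y i) 2 (gaussianLaw 0 σ) := fun i =>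
    (hmem i).comp_measurePreserving (hmp i)
  have hsum : MemLp (fun y : Fin n → ℝ => ∑ i, c i * y i) 2 (gaussianLaw 0 σ) :=
    memLp_finsetSum _ fun i _ => hmem' i
  refine ⟨hsum.integrable_sq, ?_⟩
  have h0 : ∫ y, (∑ i, c i * y i) ∂(gaussianLaw 0 σ) = 0 := by
    rw [integral_finsetSum _ fun i _ => (hmem' i).integrable (by norm_num)]
    refine Finset.sum_eq_zero fun i _ => ?_
    rw [← integral_map (φ := fun y : Fin n → ℝ => y i) (f := fun x => c i * x)
      (measurable_pi_apply i).aemeasurable (Continuous.aestronglyMeasurable (by fun_prop))]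
    have h : (gaussianLaw 0 σ).map (fun y => y i) = _ := (hmp i).map_eq
    rw [h, integral_const_mul, integral_id_gaussianReal, mul_zero]
  have h1 := variance_of_integral_eq_zero hsum.aemeasurable h0
  rw [← h1]
  have h2 := variance_sum_pi hmem
  simp only [Finset.sum_fn] at h2
  unfold gaussianLaw
  simp only [Pi.zero_apply]
  rw [h2]
  refine Finset.sum_congr rfl fun i _ => ?_
  rw [variance_const_mul, variance_fun_id_gaussianReal, Real.coe_toNNReal _ (hσ i).le, mul_comm]

/-- The mean of the squared norm of the projection of a centred Gaussian vector. -/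
lemma lintegral_projSq_le (σ : Fin n → ℝ) (hσ : ∀ i, 0 < σ i) {σ₁ : ℝ}
    (hσ₁ : ∀ i, σ i ≤ σ₁) :
    ∫⁻ y, ENNReal.ofReal (projSq F y) ∂(gaussianLaw 0 σ) ≤
      ENNReal.ofReal (σ₁ * Module.finrank ℝ F) := by
  have h := fun k => integral_linear_sq_gaussianLaw σ hσ
    (fun i => (stdOrthonormalBasis ℝ F k : EuclideanSpace ℝ (Fin n)) i)
  simp_rw [← sum_sq_projCoeff]
  have h' : ∀ k, Integrable (fun y => projCoeff F y k ^ 2) (gaussianLaw 0 σ) := fun k => (h k).1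
  rw [← ofReal_integral_eq_lintegral_ofReal (integrable_finsetSum _ fun k _ => h' k)
    (Filter.Eventually.of_forall fun y => Finset.sum_nonneg fun _ _ => sq_nonneg _),
    integral_finsetSum _ fun k _ => h' k]
  refine ENNReal.ofReal_le_ofReal ?_
  calc _ ≤ ∑ k : Fin (Module.finrank ℝ F), σ₁ := by
        refine Finset.sum_le_sum fun k _ => ?_
        rw [show (∫ y, projCoeff F y k ^ 2 ∂(gaussianLaw 0 σ)) = _ from (h k).2]
        have h1 : ∑ i, ((stdOrthonormalBasis ℝ F k : EuclideanSpace ℝ (Fin n)) i) ^ 2 = 1 := by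
          have := (stdOrthonormalBasis ℝ F).orthonormal.1 k
          have h2 : ‖(stdOrthonormalBasis ℝ F k : EuclideanSpace ℝ (Fin n))‖ ^ 2 = 1 := by
            rw [← Submodule.coe_norm, this, one_pow]
          rw [EuclideanSpace.norm_sq_eq] at h2
          simpa using h2
        calc _ ≤ ∑ i, σ₁ * ((stdOrthonormalBasis ℝ F k : EuclideanSpace ℝ (Fin n)) i) ^ 2 :=
              Finset.sum_le_sum fun i _ => mul_le_mul_of_nonneg_right (hσ₁ i) (sq_nonneg _)
          _ = σ₁ := by rw [← Finset.mul_sum, h1, mul_one]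
    _ = _ := by simp [mul_comm]

end Projection

/-! ### Elementary inequalities behind the moment bound for sums. -/

section MomentSum

/-- A second order bound for the powers of the positive part, when the argument is translated. -/
lemma max_add_zero_pow_le (a b : ℝ) (j : ℕ) (hj : 2 ≤ j) :
    max (a + b) 0 ^ j ≤ (max a 0 + |b|) ^ j - j * max a 0 ^ (j - 1) * |b| +
      j * max a 0 ^ (j - 1) * b := by
  obtain ⟨p, hp, hp0, hap⟩ : ∃ p : ℝ, p = max a 0 ∧ 0 ≤ p ∧ a ≤ p :=
    ⟨_, rfl, le_max_right _ _, le_max_left _ _⟩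
  rw [← hp]
  have h1 : max (a + b) 0 ^ j ≤ max (p + b) 0 ^ j :=
    pow_le_pow_left₀ (le_max_right _ _) (max_le_max (by linarith) le_rfl) j
  refine h1.trans ?_
  rcases le_total 0 b with hb | hb
  · rw [abs_of_nonneg hb, max_eq_left (by linarith)]; linarith
  · obtain ⟨β, rfl⟩ : ∃ β, b = -β := ⟨-b, by ring⟩
    have hβ : 0 ≤ β := by linarith
    rw [abs_neg, abs_of_nonneg hβ, ← sub_eq_add_neg]
    -- For a negative translation the two linear terms add up instead of cancelling. The induction
    -- starts at `j = 2`; at `j = 1` the claim fails when `β > p`.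
    suffices h : max (p - β) 0 ^ j + 2 * j * p ^ (j - 1) * β ≤ (p + β) ^ j by linarith
    induction j, hj using Nat.le_induction with
    | base =>
      rcases le_total β p with h | h
      · rw [max_eq_left (by linarith)]; norm_num; nlinarith
      · rw [max_eq_right (by linarith)]; norm_num; nlinarith [sq_nonneg (p - β)]
    | succ j hj ih =>
      have ih := ih (pow_le_pow_left₀ (le_max_right _ _) (max_le_max (by linarith) le_rfl) j)
      have h2 := mul_le_mul_of_nonneg_left ih (by linarith : 0 ≤ p + β)
      obtain ⟨i, rfl⟩ : ∃ i, j = i + 1 := ⟨j - 1, by omega⟩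
      simp only [Nat.add_sub_cancel] at h2 ⊢
      rw [pow_succ' (p + β), pow_succ' (max (p - β) 0)]
      refine le_trans ?_ h2
      have hpi : 0 ≤ p ^ i := by positivity
      have hβ2 : 0 ≤ p ^ i * β ^ 2 := by positivity
      push_cast
      rcases le_total β p with h | h
      · rw [max_eq_left (by linarith)]
        rcases hp0.eq_or_lt with hp0 | hp0
        · have : β = 0 := by linarith
          subst this
          simp [← hp0]
        -- Bernoulli's inequality for `(1 - β/p)^(i+1)`, rescaled by `p^(i+1)`.
        · have hB : p ^ (i + 1) - (i + 1) * p ^ i * β ≤ (p - β) ^ (i + 1) := by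
            have h3 := one_add_mul_le_pow (a := -(β / p))
              (by have := (div_le_one hp0).2 h; linarith) (i + 1)
            have h4 := mul_le_mul_of_nonneg_left h3 (by positivity : 0 ≤ p ^ (i + 1))
            rw [← mul_pow, show p * (1 + -(β / p)) = p - β by field_simp; ring] at h4
            refine le_trans (le_of_eq ?_) h4
            push_cast
            field_simp
            ring
          have h5 := mul_le_mul_of_nonneg_left hB hβ
          have h6 : p ^ (i + 1) = p * p ^ i := pow_succ' _ _
          rw [h6] at h5 ⊢
          nlinarith
      · rw [max_eq_right (by linarith)]
        have h6 : p ^ (i + 1) = p * p ^ i := pow_succ' _ _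
        rw [h6, zero_mul, zero_pow (by omega), zero_add, zero_add]
        have h7 : p * (p ^ i * β) ≤ β * (p ^ i * β) :=
          mul_le_mul_of_nonneg_right h (by positivity)
        have hi0 : (0 : ℝ) ≤ i := Nat.cast_nonneg i
        have h8 : 0 ≤ i * (p ^ i * β ^ 2) := by positivity
        nlinarith

/-- The one-step growth of the moment bound. -/
lemma add_pow_sub_le_sqrt_pow {u B : ℝ} (hu : 0 ≤ u) (hB : 0 < B) {q j : ℕ} (hj : 2 ≤ j)
    (hjq : j ≤ q) :
    (u + B) ^ j - j * u ^ (j - 1) * B ≤ √(u ^ 2 + 3 * q * B ^ 2) ^ j := by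
  have hq1 : (1 : ℝ) ≤ q := by exact_mod_cast (by omega : 1 ≤ q)
  have hjq' : (j : ℝ) ≤ q := by exact_mod_cast hjq
  -- If `u ≤ qB`, then `(u + B)² ≤ u² + (2q + 1)B² ≤ u² + 3qB²` already suffices. Otherwise `y =
  -- B/u` satisfies `jy ≤ 1`, so `(1 + y)^j - jy ≤ 1 + (jy)²`, and Bernoulli with exponent `j/2 ≥ 1`
  -- concludes.
  rcases le_total u (q * B) with h | h
  · have h1 : u + B ≤ √(u ^ 2 + 3 * q * B ^ 2) := by
      refine Real.le_sqrt_of_sq_le ?_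
      nlinarith [mul_le_mul_of_nonneg_right h hB.le, mul_le_mul_of_nonneg_right hq1 (sq_nonneg B)]
    have h2 := pow_le_pow_left₀ (by positivity) h1 j
    have : 0 ≤ j * u ^ (j - 1) * B := by positivity
    linarith
  · have hu0 : 0 < u := lt_of_lt_of_le (by positivity) h
    set y : ℝ := B / u with hy
    have hy0 : 0 < y := by positivity
    have hBy : B = u * y := by rw [hy]; field_simp
    have hjy : j * y ≤ 1 := by
      rw [hy, ← mul_div_assoc, div_le_one hu0]
      exact (mul_le_mul_of_nonneg_right hjq' hB.le).trans h
    have hj0 : (0 : ℝ) < j := by exact_mod_cast (by omega : 0 < j)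
    have h1 : (1 + y) ^ j ≤ 1 + j * y + (j * y) ^ 2 := by
      have h2 : (1 + y) ^ j ≤ Real.exp (j * y) := by
        rw [Real.exp_nat_mul]
        exact pow_le_pow_left₀ (by positivity) (by have := Real.add_one_le_exp y; linarith) j
      have h3 := Real.abs_exp_sub_one_sub_id_le (x := j * y)
        (by rw [abs_of_nonneg (by positivity)]; exact hjy)
      have := (abs_le.1 h3).2
      linarith
    have h4 : 1 + (j * y) ^ 2 ≤ √(1 + 3 * q * y ^ 2) ^ j := by
      have h5 := one_add_mul_self_le_rpow_one_add (s := 3 * q * y ^ 2)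
        (by have : 0 ≤ 3 * q * y ^ 2 := by positivity
            linarith) (p := (j : ℝ) / 2) (by
          have : (2 : ℝ) ≤ j := by exact_mod_cast hj
          linarith)
      have h6 : √(1 + 3 * q * y ^ 2) ^ j = (1 + 3 * q * y ^ 2) ^ ((j : ℝ) / 2) := by
        rw [Real.sqrt_eq_rpow, ← Real.rpow_natCast, ← Real.rpow_mul (by positivity)]
        congr 1; ring
      rw [h6]
      refine le_trans ?_ h5
      have h7 : (j : ℝ) * j * y ^ 2 ≤ j * q * y ^ 2 := by gcongr
      have h8 : 0 ≤ j * q * y ^ 2 := by positivity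
      nlinarith
    have h9 : √(u ^ 2 + 3 * q * B ^ 2) = u * √(1 + 3 * q * y ^ 2) := by
      rw [hBy, show u ^ 2 + 3 * q * (u * y) ^ 2 = u ^ 2 * (1 + 3 * q * y ^ 2) by ring,
        Real.sqrt_mul (by positivity), Real.sqrt_sq hu]
    rw [h9, mul_pow, hBy]
    have h10 : (u + u * y) ^ j = u ^ j * (1 + y) ^ j := by rw [← mul_pow]; ring
    have h11 : j * u ^ (j - 1) * (u * y) = u ^ j * (j * y) := by
      obtain ⟨i, rfl⟩ : ∃ i, j = i + 1 := ⟨j - 1, by omega⟩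
      simp only [Nat.add_sub_cancel, pow_succ]
      ring
    rw [h10, h11, ← mul_sub]
    exact mul_le_mul_of_nonneg_left (by linarith) (by positivity)

end MomentSum

/-! ### The exponential moment of one coordinate. -/

section LogInequality

/-- Comparison of the cumulant function of a rescaled centred square with the Kullback loss. -/
lemma neg_log_one_sub_add_le {α lam r : ℝ} (hα1 : α < 1) (hl : 0 < lam) (hlα : lam ≤ α)
    (hr : 0 < r) (hlr : lam * r ≤ α) :
    -Real.log (1 - lam + lam * r) - lam * (1 - r) ≤ lam * α * (r - 1 - Real.log r) := by
  -- The derivative is `λ(x - 1)` times a factor that is nonnegative while `λx ≤ α`, so `h` is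
  -- minimal at `1`, where it vanishes.
  set h : ℝ → ℝ := fun x => lam * α * (x - 1 - Real.log x) + Real.log (1 - lam + lam * x) +
    lam * (1 - x) with hh
  have hpos : ∀ x, 0 < x → 0 < 1 - lam + lam * x := fun x hx => by
    have := mul_pos hl hx; linarith
  have hder : ∀ x, 0 < x → HasDerivAt h (lam * (x - 1) * (α / x - lam / (1 - lam + lam * x))) x := by
    intro x hx
    have h1 : HasDerivAt (fun x : ℝ => 1 - lam + lam * x) (lam * 1) x :=
      ((hasDerivAt_id x).const_mul lam).const_add _
    have h2 := ((((hasDerivAt_id x).sub_const 1).sub (Real.hasDerivAt_log hx.ne')).const_mul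
      (lam * α)).add (h1.log (hpos x hx).ne')
    have h3 := h2.add (((hasDerivAt_id x).const_sub 1).const_mul lam)
    refine h3.congr_deriv ?_
    have := hpos x hx
    field_simp
    ring
  have hsign : ∀ x, 0 < x → lam * x ≤ α → 0 ≤ α / x - lam / (1 - lam + lam * x) := by
    intro x hx hx2
    rw [sub_nonneg, div_le_div_iff₀ (hpos x hx) hx]
    nlinarith [mul_le_mul_of_nonneg_right hx2 (by linarith : 0 ≤ 1 - α)]
  have h1 : h 1 = 0 := by simp [hh]
  suffices hs : 0 ≤ h r by
    simp only [hh] at hs; linarith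
  rw [← h1]
  rcases le_total 1 r with h1r | h1r
  · have hm : MonotoneOn h (Set.Icc 1 r) := by
      refine monotoneOn_of_deriv_nonneg (convex_Icc _ _) ?_ ?_ ?_
      · exact fun x hx => (hder x (by linarith [hx.1])).continuousAt.continuousWithinAt
      · rw [interior_Icc]
        exact fun x hx => (hder x (by linarith [hx.1])).differentiableAt.differentiableWithinAt
      · rw [interior_Icc]
        intro x hx
        have hx0 : 0 < x := by linarith [hx.1]
        rw [(hder x hx0).deriv]
        refine mul_nonneg (mul_nonneg hl.le (by linarith [hx.1])) (hsign x hx0 ?_)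
        exact (mul_le_mul_of_nonneg_left hx.2.le hl.le).trans hlr
    exact hm ⟨le_rfl, h1r⟩ ⟨h1r, le_rfl⟩ h1r
  · have hm : AntitoneOn h (Set.Icc r 1) := by
      refine antitoneOn_of_deriv_nonpos (convex_Icc _ _) ?_ ?_ ?_
      · exact fun x hx => (hder x (by linarith [hx.1])).continuousAt.continuousWithinAt
      · rw [interior_Icc]
        exact fun x hx => (hder x (by linarith [hx.1])).differentiableAt.differentiableWithinAt
      · rw [interior_Icc]
        intro x hx
        have hx0 : 0 < x := by linarith [hx.1]
        rw [(hder x hx0).deriv]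
        refine mul_nonpos_of_nonpos_of_nonneg
          (mul_nonpos_of_nonneg_of_nonpos hl.le (by linarith [hx.2])) (hsign x hx0 ?_)
        nlinarith [hx.2]
    exact hm ⟨le_rfl, h1r⟩ ⟨h1r, le_rfl⟩ h1r

/-- The exponential moment of one coordinate of the centred log-likelihood, compensated by a
fraction of the Kullback loss. -/
lemma lintegral_exp_coord_le_one {α lam σ τ : ℝ} (u : ℝ) (hα1 : α < 1) (hl : 0 < lam)
    (hlα : lam ≤ α) (hσ : 0 < σ) (hτ : 0 < τ) (hlr : lam * (σ / τ) ≤ α) :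
    ∫⁻ e, ENNReal.ofReal (Real.exp (lam * ((1 / 2) * ((1 - σ / τ) * (e ^ 2 / σ - 1)) - e * u / τ -
      α / 2 * (u ^ 2 / τ + (Real.log (τ / σ) + 1 / (τ / σ) - 1)))))
      ∂(gaussianReal 0 σ.toNNReal) ≤ 1 := by
  obtain ⟨r, hr⟩ : ∃ r, r = σ / τ := ⟨_, rfl⟩
  have hr0 : 0 < r := by rw [hr]; positivity
  have hτr : τ = σ / r := by rw [hr]; field_simp
  rw [← hr] at hlr ⊢
  have hlog : Real.log (τ / σ) = -Real.log r := by rw [hr, ← Real.log_inv, inv_div]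
  have hinv : 1 / (τ / σ) = r := by rw [hr]; field_simp
  rw [hlog, hinv]
  set p : ℝ := lam * (1 - r) / (2 * σ) with hp
  set k : ℝ := -(lam * u / τ) with hk
  set c : ℝ := -(lam * (1 - r) / 2) - lam * (α / 2) * (u ^ 2 / τ + (-Real.log r + r - 1)) with hc
  have hD : 0 < 1 - lam + lam * r := by have := mul_pos hl hr0; linarith
  have h2p : 1 - 2 * p * (σ.toNNReal : ℝ) = 1 - lam + lam * r := by
    rw [Real.coe_toNNReal _ hσ.le, hp]; field_simp; ring
  have h1 : ∀ e : ℝ, ENNReal.ofReal (Real.exp (lam * ((1 / 2) * ((1 - r) * (e ^ 2 / σ - 1)) -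
      e * u / τ - α / 2 * (u ^ 2 / τ + (-Real.log r + r - 1))))) =
      ENNReal.ofReal (Real.exp c) * ENNReal.ofReal (Real.exp (p * e ^ 2 + k * e)) := by
    intro e
    rw [← ENNReal.ofReal_mul (Real.exp_pos _).le, ← Real.exp_add]
    congr 2
    rw [hc, hp, hk]
    field_simp
    ring
  simp_rw [h1]
  rw [lintegral_const_mul _ (by fun_prop), lintegral_exp_quadratic_gaussianReal
    (Real.toNNReal_pos.2 hσ).ne' p k (by linarith), h2p, ← ENNReal.ofReal_mul (Real.exp_pos _).le,
    Real.coe_toNNReal _ hσ.le]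
  refine ENNReal.ofReal_le_one.2 ?_
  have hsq : √(1 - lam + lam * r) = Real.exp (Real.log (1 - lam + lam * r) / 2) := by
    rw [Real.sqrt_eq_rpow, Real.rpow_def_of_pos hD]; congr 1; ring
  rw [hsq, ← Real.exp_sub, ← Real.exp_add]
  refine Real.exp_le_one_iff.2 ?_
  -- Of the Gaussian integral, the determinant is paid for by the variance part of the loss, and the
  -- linear term by `u²/τ`, the latter through `λr ≤ α(1 - λ + λr)`.
  have hlog2 := neg_log_one_sub_add_le hα1 hl hlα hr0 hlr
  have hu : k ^ 2 * σ / (2 * (1 - lam + lam * r)) ≤ lam * (α / 2) * (u ^ 2 / τ) := by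
    have h3 : k ^ 2 * σ = lam * (lam * r) * (u ^ 2 / τ) := by
      rw [hk, hτr]; field_simp
    rw [h3, div_le_iff₀ (by positivity)]
    have h4 : lam * r ≤ α * (1 - lam + lam * r) := by
      nlinarith [mul_le_mul_of_nonneg_right hlr (by linarith : 0 ≤ 1 - α)]
    have h5 : 0 ≤ lam * (u ^ 2 / τ) := by positivity
    nlinarith [mul_le_mul_of_nonneg_right h4 h5]
  rw [hc]
  linarith

end LogInequality

/-! ### Moments of sums of independent centred variables. -/

section MomentSum

variable {Ω : Type*} [MeasurableSpace Ω] {μ : Measure Ω}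

/-- The omitted term is the one linear in `b`: for a centred summand it contributes nothing, so the
first absolute moment is never needed. -/
lemma add_pow_sub_eq_sum (a b : ℝ) {j : ℕ} (hj : 1 ≤ j) :
    (a + b) ^ j - j * a ^ (j - 1) * b =
      ∑ i ∈ (Finset.range (j + 1)).erase (j - 1), a ^ i * b ^ (j - i) * (j.choose i : ℝ) := by
  rw [add_pow, ← Finset.add_sum_erase _ _ (show j - 1 ∈ Finset.range (j + 1) by
    rw [Finset.mem_range]; omega)]
  rw [show j - (j - 1) = 1 by omega, show j.choose (j - 1) = j by
    rw [Nat.choose_symm hj, Nat.choose_one_right]]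
  ring

/-- One step of the moment inequality for sums of independent centred variables. -/
lemma integral_max_add_pow_le {S ξ : Ω → ℝ} (hS : Measurable S) (hξ : Measurable ξ)
    (hind : IndepFun S ξ μ) {q : ℕ} {u B : ℝ}
    (hSi : ∀ j ≤ q, Integrable (fun ω => max (S ω) 0 ^ j) μ)
    (hSu : ∀ j ≤ q, ∫ ω, max (S ω) 0 ^ j ∂μ ≤ u ^ j)
    (hξi : ∀ j ≤ q, Integrable (fun ω => |ξ ω| ^ j) μ)
    (hξB : ∀ j ≤ q, j ≠ 1 → ∫ ω, |ξ ω| ^ j ∂μ ≤ B ^ j)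
    (hξ0 : ∫ ω, ξ ω ∂μ = 0) (hu : 0 ≤ u) {j : ℕ} (hj : 2 ≤ j) (hjq : j ≤ q) :
    Integrable (fun ω => max (S ω + ξ ω) 0 ^ j) μ ∧
      ∫ ω, max (S ω + ξ ω) 0 ^ j ∂μ ≤ (u + B) ^ j - j * u ^ (j - 1) * B := by
  have hξint : Integrable ξ μ := by
    have := hξi 1 (by omega)
    simp only [pow_one] at this
    exact (integrable_norm_iff hξ.aestronglyMeasurable).1 this
  set f : ℕ → Ω → ℝ := fun i ω => max (S ω) 0 ^ i * |ξ ω| ^ (j - i) with hf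
  have hindi : ∀ i l : ℕ, IndepFun (fun ω => max (S ω) 0 ^ i) (fun ω => |ξ ω| ^ l) μ := fun i l =>
    hind.comp (φ := fun x : ℝ => max x 0 ^ i) (ψ := fun x : ℝ => |x| ^ l)
      (by fun_prop) (by fun_prop)
  have hind1 : IndepFun (fun ω => max (S ω) 0 ^ (j - 1)) ξ μ :=
    hind.comp (φ := fun x : ℝ => max x 0 ^ (j - 1)) (ψ := fun x : ℝ => x)
      (by fun_prop) (by fun_prop)
  have hfi : ∀ i ≤ j, Integrable (f i) μ := fun i hi =>
    (hindi i (j - i)).integrable_mul (hSi i (by omega)) (hξi (j - i) (by omega))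
  have hfE : ∀ i ≤ j, i ≠ j - 1 → ∫ ω, f i ω ∂μ ≤ u ^ i * B ^ (j - i) := by
    intro i hi hij
    have h := (hindi i (j - i)).integral_mul_eq_mul_integral
      (hSi i (by omega)).aestronglyMeasurable (hξi (j - i) (by omega)).aestronglyMeasurable
    have h' : ∫ ω, f i ω ∂μ = _ := h
    rw [h']
    exact mul_le_mul (hSu i (by omega)) (hξB _ (by omega) (by omega))
      (integral_nonneg fun ω => by positivity) (by positivity)
  have h1i : Integrable (fun ω => max (S ω) 0 ^ (j - 1) * ξ ω) μ :=
    hind1.integrable_mul (hSi _ (by omega)) hξint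
  have h1E : ∫ ω, max (S ω) 0 ^ (j - 1) * ξ ω ∂μ = 0 := by
    have h := hind1.integral_mul_eq_mul_integral
      (hSi (j - 1) (by omega)).aestronglyMeasurable hξint.aestronglyMeasurable
    have h' : ∫ ω, max (S ω) 0 ^ (j - 1) * ξ ω ∂μ = _ := h
    rw [h', hξ0, mul_zero]
  -- In this dominating function the degree one term carries `ξ` with its sign, hence has mean zero
  -- by independence.
  set g : Ω → ℝ := fun ω => (∑ i ∈ (Finset.range (j + 1)).erase (j - 1),
    f i ω * (j.choose i : ℝ)) + j * (max (S ω) 0 ^ (j - 1) * ξ ω) with hg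
  have hsi : ∀ i ∈ (Finset.range (j + 1)).erase (j - 1), Integrable
      (fun ω => f i ω * (j.choose i : ℝ)) μ := fun i hi =>
    (hfi i (by rw [Finset.mem_erase, Finset.mem_range] at hi; omega)).mul_const _
  have hgi : Integrable g μ := (integrable_finsetSum _ hsi).add (h1i.const_mul _)
  have hle : ∀ ω, max (S ω + ξ ω) 0 ^ j ≤ g ω := by
    intro ω
    have h := max_add_zero_pow_le (S ω) (ξ ω) j hj
    rw [add_pow_sub_eq_sum _ _ (by omega)] at h
    rw [hg, hf]
    simp only
    linarith
  have hint : Integrable (fun ω => max (S ω + ξ ω) 0 ^ j) μ :=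
    hgi.mono' (Measurable.aestronglyMeasurable (by fun_prop))
      (Filter.Eventually.of_forall fun ω => by
        rw [Real.norm_of_nonneg (by positivity)]; exact hle ω)
  refine ⟨hint, (integral_mono hint hgi hle).trans ?_⟩
  rw [hg, integral_add (integrable_finsetSum _ hsi) (h1i.const_mul _), integral_const_mul, h1E,
    mul_zero, add_zero, integral_finsetSum _ hsi, add_pow_sub_eq_sum _ _ (by omega)]
  refine Finset.sum_le_sum fun i hi => ?_
  rw [Finset.mem_erase, Finset.mem_range] at hi
  rw [integral_mul_const]
  exact mul_le_mul_of_nonneg_right (hfE i (by omega) hi.1) (Nat.cast_nonneg _)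

/-- A moment inequality for the positive part of a sum of independent centred variables. -/
lemma integral_max_sum_pow_le [IsProbabilityMeasure μ] {ι : Type*} {ξ : ι → Ω → ℝ} (hξ : ∀ i, Measurable (ξ i))
    (hind : iIndepFun ξ μ) {q : ℕ} (hq : 2 ≤ q) {B : ℝ} (hB : 0 < B)
    (hξi : ∀ i, ∀ j ≤ q, Integrable (fun ω => |ξ i ω| ^ j) μ)
    (hξB : ∀ i, ∀ j ≤ q, j ≠ 1 → ∫ ω, |ξ i ω| ^ j ∂μ ≤ B ^ j)
    (hξ0 : ∀ i, ∫ ω, ξ i ω ∂μ = 0) (s : Finset ι) :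
    ∀ j ≤ q, Integrable (fun ω => max (∑ i ∈ s, ξ i ω) 0 ^ j) μ ∧
      ∫ ω, max (∑ i ∈ s, ξ i ω) 0 ^ j ∂μ ≤ (√(3 * q * s.card) * B) ^ j := by
  classical
  induction s using Finset.induction_on with
  | empty =>
    intro j _
    simp
  | insert k s hk ih =>
    have hS : Measurable fun ω => ∑ i ∈ s, ξ i ω := Finset.measurable_sum _ fun i _ => hξ i
    have hi : IndepFun (fun ω => ∑ i ∈ s, ξ i ω) (ξ k) μ := by
      have h := hind.indepFun_finsetSum_of_notMem hξ hk
      simpa only [Finset.sum_fn] using h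
    have hu : 0 ≤ √(3 * q * s.card) * B := by positivity
    have hsum : ∀ ω, ∑ i ∈ insert k s, ξ i ω = ∑ i ∈ s, ξ i ω + ξ k ω := fun ω => by
      rw [Finset.sum_insert hk, add_comm]
    set v := √(3 * q * (insert k s).card) * B with hv
    have hv0 : 0 < v := by
      rw [Finset.card_insert_of_notMem hk] at hv
      have : (0 : ℝ) < q := by exact_mod_cast (by omega : 0 < q)
      rw [hv]
      positivity
    -- Each new variable adds `3qB²` to the square of the bound.
    have hv2 : √((√(3 * q * s.card) * B) ^ 2 + 3 * q * B ^ 2) = v := by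
      rw [mul_pow, Real.sq_sqrt (by positivity), hv, Finset.card_insert_of_notMem hk]
      rw [show 3 * (q : ℝ) * s.card * B ^ 2 + 3 * q * B ^ 2 =
        (3 * q * ((s.card + 1 : ℕ) : ℝ)) * B ^ 2 by push_cast; ring,
        Real.sqrt_mul (by positivity), Real.sqrt_sq hB.le]
    have h2 : ∀ j, 2 ≤ j → j ≤ q →
        Integrable (fun ω => max (∑ i ∈ insert k s, ξ i ω) 0 ^ j) μ ∧
        ∫ ω, max (∑ i ∈ insert k s, ξ i ω) 0 ^ j ∂μ ≤ v ^ j := by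
      intro j hj hjq
      simp_rw [hsum]
      have h := integral_max_add_pow_le hS (hξ k) hi (fun j hj => (ih j hj).1)
        (fun j hj => (ih j hj).2) (hξi k) (hξB k) (hξ0 k) hu hj hjq
      refine ⟨h.1, h.2.trans ?_⟩
      rw [← hv2]
      exact add_pow_sub_le_sqrt_pow hu hB hj hjq
    intro j hjq
    rcases Nat.lt_or_ge j 2 with hj | hj
    swap
    · exact h2 j hj hjq
    · interval_cases j
      · simp
      · obtain ⟨h2i, h2v⟩ := h2 2 le_rfl hq
        -- The one-step bound requires `j ≥ 2`; order one is recovered from order two by `2vz ≤ z² +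
        -- v²`.
        have hle : ∀ ω, max (∑ i ∈ insert k s, ξ i ω) 0 ^ 1 ≤
            (2 * v)⁻¹ * max (∑ i ∈ insert k s, ξ i ω) 0 ^ 2 + v / 2 := by
          intro ω
          set z := max (∑ i ∈ insert k s, ξ i ω) 0
          have : (2 * v)⁻¹ * z ^ 2 + v / 2 - z ^ 1 = (2 * v)⁻¹ * (z - v) ^ 2 := by
            field_simp; ring
          have h3 : 0 ≤ (2 * v)⁻¹ * (z - v) ^ 2 := by positivity
          linarith
        have hmi : Integrable (fun ω => (2 * v)⁻¹ * max (∑ i ∈ insert k s, ξ i ω) 0 ^ 2 + v / 2) μ :=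
          (h2i.const_mul _).add (integrable_const _)
        have hint : Integrable (fun ω => max (∑ i ∈ insert k s, ξ i ω) 0 ^ 1) μ := by
          refine hmi.mono' ?_ (Filter.Eventually.of_forall fun ω => by
            rw [Real.norm_of_nonneg (by positivity)]; exact hle ω)
          have : Measurable fun ω => ∑ i ∈ insert k s, ξ i ω :=
            Finset.measurable_sum _ fun i _ => hξ i
          exact Measurable.aestronglyMeasurable (by fun_prop)
        refine ⟨hint, (integral_mono hint hmi hle).trans ?_⟩
        rw [integral_add (h2i.const_mul _) (integrable_const _), integral_const_mul]
        simp only [integral_const, probReal_univ, one_smul, pow_one]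
        have h4 := mul_le_mul_of_nonneg_left h2v (by positivity : 0 ≤ (2 * v)⁻¹)
        have h5 : (2 * v)⁻¹ * v ^ 2 = v / 2 := by field_simp
        linarith

/-- A bound on the mean excess of a sum of independent nonnegative variables over its mean. -/
lemma lintegral_sum_sub_le [IsProbabilityMeasure μ] {ι : Type*} [Fintype ι] {X : ι → Ω → ℝ} (hX : ∀ i, Measurable (X i))
    (hX0 : ∀ i ω, 0 ≤ X i ω) (hind : iIndepFun X μ) {q : ℕ} (hq : 2 ≤ q) {A a h : ℝ} (hA : 0 < A)
    (ha : 0 ≤ a) (hh : 0 < h) (hXa : ∀ i, ∫⁻ ω, ENNReal.ofReal (X i ω) ∂μ ≤ ENNReal.ofReal a)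
    (hXA : ∀ i j, 1 ≤ j → j ≤ q → ∫⁻ ω, ENNReal.ofReal (X i ω ^ j) ∂μ ≤ ENNReal.ofReal (A ^ j)) :
    ∫⁻ ω, ENNReal.ofReal (∑ i, X i ω - Fintype.card ι * a - h) ∂μ ≤
      ENNReal.ofReal ((√(3 * q * Fintype.card ι) * (√2 * A)) ^ q / h ^ (q - 1)) := by
  have hXi : ∀ i j, j ≤ q → Integrable (fun ω => X i ω ^ j) μ := by
    intro i j hj
    rcases Nat.eq_zero_or_pos j with rfl | hj0
    · simp
    refine (lintegral_ofReal_ne_top_iff_integrable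
      (Measurable.aestronglyMeasurable (by have := hX i; fun_prop))
      (Filter.Eventually.of_forall fun ω => pow_nonneg (hX0 i ω) _)).1 ?_
    exact ((hXA i j hj0 hj).trans_lt ENNReal.ofReal_lt_top).ne
  have hXE : ∀ i j, 1 ≤ j → j ≤ q → ∫ ω, X i ω ^ j ∂μ ≤ A ^ j := by
    intro i j hj1 hj
    have h1 := hXA i j hj1 hj
    rwa [← ofReal_integral_eq_lintegral_ofReal (hXi i j hj)
      (Filter.Eventually.of_forall fun ω => pow_nonneg (hX0 i ω) _),
      ENNReal.ofReal_le_ofReal_iff (by positivity)] at h1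
  have hXint : ∀ i, Integrable (X i) μ := fun i => by simpa using hXi i 1 (by omega)
  have hXm : ∀ i, ∫ ω, X i ω ∂μ ≤ a := by
    intro i
    have h1 := hXa i
    rwa [← ofReal_integral_eq_lintegral_ofReal (hXint i)
      (Filter.Eventually.of_forall fun ω => hX0 i ω), ENNReal.ofReal_le_ofReal_iff ha] at h1
  set m : ι → ℝ := fun i => ∫ ω, X i ω ∂μ with hm
  have hm0 : ∀ i, 0 ≤ m i := fun i => integral_nonneg (hX0 i)
  have hmA : ∀ i, m i ≤ A := fun i => by simpa using hXE i 1 le_rfl (by omega)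
  have habs : ∀ i j ω, |X i ω - m i| ^ j ≤ X i ω ^ j + m i ^ j := by
    intro i j ω
    have h1 : |X i ω - m i| ≤ max (X i ω) (m i) := by
      rw [abs_le]
      exact ⟨by have := le_max_right (X i ω) (m i); have := hX0 i ω; linarith,
        by have := le_max_left (X i ω) (m i); have := hm0 i; linarith⟩
    refine (pow_le_pow_left₀ (abs_nonneg _) h1 j).trans ?_
    have := pow_nonneg (hX0 i ω) j
    have := pow_nonneg (hm0 i) j
    rcases max_choice (X i ω) (m i) with h2 | h2 <;> rw [h2] <;> linarith
  have hξm : ∀ i, Measurable fun ω => X i ω - m i := fun i => (hX i).sub_const _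
  have hξind : iIndepFun (fun i ω => X i ω - m i) μ :=
    hind.comp (fun i x => x - m i) fun i => by fun_prop
  have hξi : ∀ i, ∀ j ≤ q, Integrable (fun ω => |X i ω - m i| ^ j) μ := fun i j hj =>
    ((hXi i j hj).add (integrable_const (m i ^ j))).mono'
      (Measurable.aestronglyMeasurable (by have := hξm i; fun_prop))
      (Filter.Eventually.of_forall fun ω => by
        rw [Real.norm_of_nonneg (by positivity)]; exact habs i j ω)
  have hB : 0 < √2 * A := by positivity
  -- Centring costs a factor `2 ≤ √2^j`, valid for `j ≥ 2`; this is the origin of `√2` and of the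
  -- exclusion of `j = 1`.
  have hξB : ∀ i, ∀ j ≤ q, j ≠ 1 → ∫ ω, |X i ω - m i| ^ j ∂μ ≤ (√2 * A) ^ j := by
    intro i j hj hj1
    rcases Nat.eq_zero_or_pos j with rfl | hj0
    · simp
    calc _ ≤ ∫ ω, X i ω ^ j + m i ^ j ∂μ :=
          integral_mono (hξi i j hj) ((hXi i j hj).add (integrable_const _)) (habs i j)
      _ = ∫ ω, X i ω ^ j ∂μ + m i ^ j := by
          rw [integral_add (hXi i j hj) (integrable_const _)]; simp
      _ ≤ A ^ j + A ^ j :=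
          add_le_add (hXE i j hj0 hj) (pow_le_pow_left₀ (hm0 i) (hmA i) j)
      _ = 2 * A ^ j := by ring
      _ ≤ √2 ^ j * A ^ j := by
          refine mul_le_mul_of_nonneg_right ?_ (by positivity)
          have h1 : (1 : ℝ) ≤ √2 := Real.one_le_sqrt.2 (by norm_num)
          calc (2 : ℝ) = √2 ^ 2 := (Real.sq_sqrt (by norm_num)).symm
            _ ≤ √2 ^ j := pow_le_pow_right₀ h1 (by omega)
      _ = _ := by rw [mul_pow]
  have hξ0 : ∀ i, ∫ ω, (X i ω - m i) ∂μ = 0 := fun i => by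
    rw [integral_sub (hXint i) (integrable_const _)]; simp [hm]
  obtain ⟨hmi, hmE⟩ := integral_max_sum_pow_le hξm hξind hq hB hξi hξB hξ0 Finset.univ q le_rfl
  rw [Finset.card_univ] at hmE
  -- As in Markov's inequality: `z ≤ z^q / h^(q-1)` as soon as `z ≥ h`, and otherwise the left side
  -- is nonpositive.
  have hpt : ∀ ω, ∑ i, X i ω - Fintype.card ι * a - h ≤
      max (∑ i, (X i ω - m i)) 0 ^ q / h ^ (q - 1) := by
    intro ω
    have h1 : ∑ i, X i ω - Fintype.card ι * a ≤ ∑ i, (X i ω - m i) := by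
      rw [Finset.sum_sub_distrib]
      have : ∑ i, m i ≤ ∑ _i : ι, a := Finset.sum_le_sum fun i _ => hXm i
      rw [Finset.sum_const, Finset.card_univ, nsmul_eq_mul] at this
      linarith
    set z := ∑ i, (X i ω - m i)
    rcases le_total z h with hz | hz
    · have : 0 ≤ max z 0 ^ q / h ^ (q - 1) := by positivity
      linarith
    · have hz0 : 0 < z := lt_of_lt_of_le hh hz
      rw [max_eq_left hz0.le]
      have h2 : z ≤ z ^ q / h ^ (q - 1) := by
        rw [le_div_iff₀ (by positivity)]
        calc z * h ^ (q - 1) ≤ z * z ^ (q - 1) := by gcongr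
          _ = z ^ q := by rw [← pow_succ', show q - 1 + 1 = q by omega]
      linarith
  calc _ ≤ ∫⁻ ω, ENNReal.ofReal (max (∑ i, (X i ω - m i)) 0 ^ q / h ^ (q - 1)) ∂μ :=
        lintegral_mono fun ω => ENNReal.ofReal_le_ofReal (hpt ω)
    _ = ENNReal.ofReal (∫ ω, max (∑ i, (X i ω - m i)) 0 ^ q / h ^ (q - 1) ∂μ) :=
        (ofReal_integral_eq_lintegral_ofReal (hmi.div_const _)
          (Filter.Eventually.of_forall fun ω => by positivity)).symm
    _ ≤ _ := by
        refine ENNReal.ofReal_le_ofReal ?_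
        rw [integral_div]
        gcongr

end MomentSum

/-! ### Orthogonality relations for a projection. -/

section Projection

variable {n : ℕ} (F : Submodule ℝ (EuclideanSpace ℝ (Fin n)))

/-- The orthogonal projection of a vector given by its coordinates. -/
noncomputable def projVec (y : Fin n → ℝ) : Fin n → ℝ := (F.starProjection (WithLp.toLp 2 y)).ofLp

lemma sum_mul_projVec (y : Fin n → ℝ) : ∑ i, y i * projVec F y i = projSq F y := by
  have h := Submodule.starProjection_inner_eq_zero (K := F) (WithLp.toLp 2 y)
    (F.starProjection (WithLp.toLp 2 y)) (Submodule.coe_mem _)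
  rw [inner_sub_left, sub_eq_zero, real_inner_self_eq_norm_sq, PiLp.inner_apply] at h
  rw [projSq, ← h]
  exact Finset.sum_congr rfl fun i _ => by simp [projVec, mul_comm]

lemma sum_sub_mul_projVec (z y : Fin n → ℝ) :
    ∑ i, (z i - projVec F z i) * projVec F y i = 0 := by
  have h := Submodule.starProjection_inner_eq_zero (K := F) (WithLp.toLp 2 z)
    (F.starProjection (WithLp.toLp 2 y)) (Submodule.coe_mem _)
  rw [PiLp.inner_apply] at h
  rw [← h]
  exact Finset.sum_congr rfl fun i _ => by simp [projVec, mul_comm]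

lemma sum_sub_projVec_sq (y : Fin n → ℝ) :
    ∑ i, (y i - projVec F y i) ^ 2 = projSq Fᗮ y := by
  rw [projSq, Submodule.starProjection_orthogonal_val, EuclideanSpace.norm_sq_eq]
  exact Finset.sum_congr rfl fun i _ => by simp [projVec]

end Projection

/-! ### Block structure and decomposition of the contrast. -/

namespace Model

variable {kn : ℕ} (m : Model kn)

lemma len_pos : 0 < m.len := by unfold len; positivity

lemma card_pos : 0 < m.card := by unfold card; positivity

lemma block_coord (b : Fin m.card) (j : Fin m.len) : m.block (m.coord b j) = b := by
  ext
  simp only [block, coord]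
  rw [mul_comm, Nat.mul_add_div m.len_pos, Nat.div_eq_of_lt j.2, add_zero]

/-- The coordinates are parametrized by a block and a position in this block. -/
def coordEquiv : Fin m.card × Fin m.len ≃ Fin (2 ^ kn) where
  toFun p := m.coord p.1 p.2
  invFun i := (m.block i, ⟨i % m.len, Nat.mod_lt _ m.len_pos⟩)
  left_inv p := by
    refine Prod.ext (m.block_coord p.1 p.2) (Fin.ext ?_)
    simp only [coord]
    rw [mul_comm, Nat.mul_add_mod, Nat.mod_eq_of_lt p.2.2]
  right_inv i := by
    ext
    simp only [coord, block]
    rw [mul_comm]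
    exact Nat.div_add_mod _ _

lemma sum_eq_sum_coord {A : Type*} [AddCommMonoid A] (f : Fin (2 ^ kn) → A) :
    ∑ i, f i = ∑ b, ∑ j, f (m.coord b j) := by
  rw [← Fintype.sum_prod_type', ← m.coordEquiv.sum_comp]
  rfl

/-- The coordinates of a vector in the block `b`. -/
def blockVec (b : Fin m.card) (y : Fin (2 ^ kn) → ℝ) : Fin m.len → ℝ := fun j => y (m.coord b j)

@[fun_prop]
lemma measurable_blockVec (b : Fin m.card) : Measurable (m.blockVec b) :=
  measurable_pi_lambda _ fun _ => measurable_pi_apply _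

/-- The space `E_m`, as a subspace of `ℝ^m.len`. -/
def space : Submodule ℝ (EuclideanSpace ℝ (Fin m.len)) := m.E

/-- The orthogonal projection on `S_m` acts blockwise. -/
lemma proj_coord (y : Fin (2 ^ kn) → ℝ) (b : Fin m.card) (j : Fin m.len) :
    m.proj y (m.coord b j) = projVec m.space (m.blockVec b y) j := by
  -- The blockwise projections glue to a vector of `S_m` whose residual is orthogonal to `S_m`,
  -- hence to the projection.
  set v : EuclideanSpace ℝ (Fin (2 ^ kn)) := WithLp.toLp 2 fun i =>
    projVec m.space (m.blockVec (m.coordEquiv.symm i).1 y) (m.coordEquiv.symm i).2 with hv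
  have hvc : ∀ b j, v (m.coord b j) = projVec m.space (m.blockVec b y) j := by
    intro b j
    have : m.coordEquiv.symm (m.coord b j) = (b, j) := m.coordEquiv.symm_apply_apply (b, j)
    rw [hv]
    simp only [this]
  have h : m.S.starProjection (WithLp.toLp 2 y) = v := by
    refine Submodule.eq_starProjection_of_mem_of_inner_eq_zero (fun b => ?_) fun w hw => ?_
    · have : m.restrict b v.ofLp = m.space.starProjection (WithLp.toLp 2 (m.blockVec b y)) := by
        ext j
        exact hvc b j
      rw [this]
      exact Submodule.coe_mem _
    · rw [PiLp.inner_apply, m.sum_eq_sum_coord]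
      refine Finset.sum_eq_zero fun b _ => ?_
      have h := Submodule.starProjection_inner_eq_zero (K := m.space)
        (WithLp.toLp 2 (m.blockVec b y)) (WithLp.toLp 2 (m.blockVec b w.ofLp)) (hw b)
      rw [PiLp.inner_apply] at h
      rw [← h]
      refine Finset.sum_congr rfl fun j _ => ?_
      rw [PiLp.sub_apply, hvc]
      rfl
  rw [proj, h]
  exact hvc b j

/-- The residual sum of squares of the block `b`. -/
noncomputable def rss (b : Fin m.card) (y : Fin (2 ^ kn) → ℝ) : ℝ := projSq m.spaceᗮ (m.blockVec b y)

lemma blockVar_eq (y : Fin (2 ^ kn) → ℝ) (b : Fin m.card) :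
    m.blockVar y b = m.rss b y / m.len := by
  rw [blockVar, rss, ← sum_sub_projVec_sq, one_div, inv_mul_eq_div]
  simp_rw [m.proj_coord]
  rfl

lemma varEst_coord (y : Fin (2 ^ kn) → ℝ) (b : Fin m.card) (j : Fin m.len) :
    m.varEst y (m.coord b j) = m.rss b y / m.len := by
  rw [varEst, block_coord, blockVar_eq]

lemma varEst_eq (y : Fin (2 ^ kn) → ℝ) (i : Fin (2 ^ kn)) :
    m.varEst y i = m.rss (m.block i) y / m.len := by
  rw [varEst, blockVar_eq]

lemma proj_add (y z : Fin (2 ^ kn) → ℝ) : m.proj (y + z) = m.proj y + m.proj z := by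
  simp [proj]

/-- The squared norm of the projection of the noise, weighted by the inverse of the estimated
variances. -/
noncomputable def noise (b : Fin m.card) (e y : Fin (2 ^ kn) → ℝ) : ℝ :=
  projSq m.space (m.blockVec b e) * (m.len / m.rss b y)

/-- The estimated variance is constant on a block, so this is `⟨e, Πe⟩ = ‖Πe‖²` block by block. -/
lemma sum_mul_proj_div (e y : Fin (2 ^ kn) → ℝ) :
    ∑ i, e i * m.proj e i / m.varEst y i = ∑ b, m.noise b e y := by
  rw [m.sum_eq_sum_coord]
  refine Finset.sum_congr rfl fun b _ => ?_
  simp_rw [varEst_coord, proj_coord]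
  rw [← Finset.sum_div, noise, ← sum_mul_projVec, div_div_eq_mul_div, mul_div_assoc]
  rfl

/-- On each block the weights are constant and the residual of `s` is orthogonal to the projected
noise. -/
lemma sum_bias_mul_proj_div (s e y : Fin (2 ^ kn) → ℝ) :
    ∑ i, (s i - m.proj s i) * m.proj e i / m.varEst y i = 0 := by
  rw [m.sum_eq_sum_coord]
  refine Finset.sum_eq_zero fun b _ => ?_
  simp_rw [varEst_coord, proj_coord]
  rw [← Finset.sum_div]
  have := sum_sub_mul_projVec m.space (m.blockVec b s) (m.blockVec b e)
  rw [show (∑ j : Fin m.len, (s (m.coord b j) - projVec m.space (m.blockVec b s) j) *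
    projVec m.space (m.blockVec b e) j) = 0 from this, zero_div]

/-- The explicit formula for the Kullback loss. -/
noncomputable def lossReal (s σ e y : Fin (2 ^ kn) → ℝ) : ℝ :=
  (1 / 2) * ∑ i, ((s i - m.proj (s + e) i) ^ 2 / m.varEst y i +
      (Real.log (m.varEst y i / σ i) + 1 / (m.varEst y i / σ i) - 1))

/-- The centred part of the difference between the Kullback loss and the likelihood contrast. -/
noncomputable def fluct (s σ e y : Fin (2 ^ kn) → ℝ) : ℝ :=
  ∑ i, ((1 / 2) * ((1 - σ i / m.varEst y i) * (e i ^ 2 / σ i - 1)) -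
    e i * (s i - m.proj s i) / m.varEst y i)

/-- The Kullback loss without the projected noise. -/
noncomputable def bias (s σ y : Fin (2 ^ kn) → ℝ) : ℝ :=
  (1 / 2) * ∑ i, ((s i - m.proj s i) ^ 2 / m.varEst y i +
      (Real.log (m.varEst y i / σ i) + 1 / (m.varEst y i / σ i) - 1))

/-- The central identity. With `b = s - π_m s`, the residual of the first sample is `e + b - π_m e`.
Expanding its square around `b - π_m e`, the product of `e` with `b` goes into the fluctuations and
its product with `π_m e` is the noise. -/
lemma likelihood_sub_eq (s σ e y : Fin (2 ^ kn) → ℝ) (hσ : ∀ i, 0 < σ i)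
    (hy : ∀ b, 0 < m.rss b y) :
    likelihood (s + e) (m.proj (s + e)) (m.varEst y) - likelihood (s + e) s σ =
      m.lossReal s σ e y - m.fluct s σ e y - ∑ b, m.noise b e y := by
  rw [likelihood, likelihood, lossReal, fluct, ← sum_mul_proj_div, ← mul_sub,
    ← Finset.sum_sub_distrib, Finset.mul_sum, Finset.mul_sum, ← Finset.sum_sub_distrib,
    ← Finset.sum_sub_distrib]
  refine Finset.sum_congr rfl fun i _ => ?_
  have hτ : 0 < m.varEst y i := by
    rw [varEst_eq]; exact div_pos (hy _) (by exact_mod_cast m.len_pos)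
  have hσi := hσ i
  rw [proj_add, Real.log_div hτ.ne' hσi.ne']
  simp only [Pi.add_apply]
  field_simp
  ring

/-- Pythagoras, blockwise. Unlike the loss, `bias` depends on the second sample alone, so it can
serve as a compensator when that sample is frozen. -/
lemma bias_le_lossReal (s σ e y : Fin (2 ^ kn) → ℝ) (hy : ∀ b, 0 ≤ m.rss b y) :
    m.bias s σ y ≤ m.lossReal s σ e y := by
  have h := m.sum_bias_mul_proj_div s e y
  have h1 : m.lossReal s σ e y = m.bias s σ y -
      ∑ i, (s i - m.proj s i) * m.proj e i / m.varEst y i +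
      (1 / 2) * ∑ i, m.proj e i ^ 2 / m.varEst y i := by
    rw [lossReal, bias, Finset.mul_sum, Finset.mul_sum, Finset.mul_sum,
      ← Finset.sum_sub_distrib, ← Finset.sum_add_distrib]
    refine Finset.sum_congr rfl fun i _ => ?_
    rw [proj_add]
    simp only [Pi.add_apply]
    ring
  rw [h1, h]
  have : 0 ≤ ∑ i, m.proj e i ^ 2 / m.varEst y i := by
    refine Finset.sum_nonneg fun i _ => ?_
    rw [varEst_eq]
    exact div_nonneg (sq_nonneg _) (div_nonneg (hy _) (Nat.cast_nonneg _))
  linarith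

lemma lossReal_nonneg (s σ e y : Fin (2 ^ kn) → ℝ) (hσ : ∀ i, 0 < σ i)
    (hy : ∀ b, 0 < m.rss b y) : 0 ≤ m.lossReal s σ e y := by
  refine mul_nonneg (by norm_num) (Finset.sum_nonneg fun i _ => ?_)
  have hτ : 0 < m.varEst y i := by
    rw [varEst_eq]; exact div_pos (hy _) (by exact_mod_cast m.len_pos)
  have h1 : 0 ≤ (s i - m.proj (s + e) i) ^ 2 / m.varEst y i := by positivity
  have hr : 0 < m.varEst y i / σ i := div_pos hτ (hσ i)
  have h2 := Real.one_sub_inv_le_log_of_pos hr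
  rw [one_div]
  linarith

lemma loss_eq (s σ e y : Fin (2 ^ kn) → ℝ) (hσ : ∀ i, 0 < σ i)
    (hy : ∀ b, 0 < m.rss b y) :
    m.loss s σ (s + e) y = ENNReal.ofReal (m.lossReal s σ e y) := by
  rw [loss, kullback_eq s σ _ _ hσ]
  · rfl
  · intro i
    rw [varEst_eq]; exact div_pos (hy _) (by exact_mod_cast m.len_pos)

end Model

/-! ### Independence of the blocks. -/

/-- The noise vector `y - s` of a Gaussian vector is a centred Gaussian vector. -/
lemma map_sub_gaussianLaw {n : ℕ} (s σ : Fin n → ℝ) :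
    (gaussianLaw s σ).map (fun y => y - s) = gaussianLaw 0 σ := by
  unfold gaussianLaw
  have h := Measure.pi_map_pi (μ := fun i => gaussianReal (s i) (σ i).toNNReal)
    (f := fun i x => x - s i)
    (hμ := fun i => by rw [gaussianReal_map_sub_const]; infer_instance)
    (fun i => by fun_prop)
  rw [show (fun y : Fin n → ℝ => y - s) = fun x i => x i - s i from rfl, h]
  congr 1
  ext1 i
  rw [gaussianReal_map_sub_const, sub_self]
  rfl

/-- The blocks of a vector with independent coordinates are independent. -/
lemma map_curry_pi {ι κ η : Type*} [Fintype ι] [Fintype κ] [Fintype η] (f : ι × κ ≃ η)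
    (ν : η → Measure ℝ) [∀ i, IsProbabilityMeasure (ν i)] :
    (Measure.pi ν).map (fun y b j => y (f (b, j))) =
      Measure.pi fun b => Measure.pi fun j => ν (f (b, j)) := by
  set g : (ι → κ → ℝ) → (η → ℝ) := fun z i => z (f.symm i).1 (f.symm i).2 with hg
  have hgm : Measurable g := measurable_pi_lambda _ fun i => by
    simp only [hg]
    exact (measurable_pi_apply _).comp (measurable_pi_apply _)
  -- The inverse map `g` is easier: preimages of boxes are boxes, and both measures multiply there.
  have h : (Measure.pi fun b => Measure.pi fun j => ν (f (b, j))).map g = Measure.pi ν := by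
    refine (Measure.pi_eq fun A hA => ?_).symm
    rw [Measure.map_apply hgm (MeasurableSet.univ_pi hA)]
    have hpre : g ⁻¹' (Set.univ.pi A) =
        Set.univ.pi fun b => Set.univ.pi fun j => A (f (b, j)) := by
      ext z
      simp only [hg, Set.mem_preimage, Set.mem_pi, Set.mem_univ, true_implies]
      constructor
      · intro h b j
        simpa using h (f (b, j))
      · intro h i
        simpa using h (f.symm i).1 (f.symm i).2
    rw [hpre, Measure.pi_pi]
    simp_rw [Measure.pi_pi]
    rw [← Fintype.prod_prod_type', ← f.prod_comp]
  have hm : Measurable fun (y : η → ℝ) (b : ι) (j : κ) => y (f (b, j)) := by fun_prop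
  rw [← h, Measure.map_map hm hgm]
  convert Measure.map_id
  ext z b j
  simp [hg]

namespace Model

variable {kn : ℕ} (m : Model kn)

lemma measurePreserving_blocks (s σ : Fin (2 ^ kn) → ℝ) :
    MeasurePreserving (fun y b => m.blockVec b y) (gaussianLaw s σ)
      (Measure.pi fun b => gaussianLaw (m.blockVec b s) (m.blockVec b σ)) where
  measurable := measurable_pi_lambda _ fun b => m.measurable_blockVec b
  map_eq := map_curry_pi m.coordEquiv fun i => gaussianReal (s i) (σ i).toNNReal

lemma measurePreserving_blockVec (s σ : Fin (2 ^ kn) → ℝ) (b : Fin m.card) :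
    MeasurePreserving (m.blockVec b) (gaussianLaw s σ)
      (gaussianLaw (m.blockVec b s) (m.blockVec b σ)) :=
  (measurePreserving_eval _ b).comp (m.measurePreserving_blocks s σ)

/-- The pairs formed by the blocks of two independent Gaussian vectors are independent. -/
lemma iIndepFun_blocks (s σ t τ : Fin (2 ^ kn) → ℝ) :
    iIndepFun (fun b (z : (Fin (2 ^ kn) → ℝ) × (Fin (2 ^ kn) → ℝ)) =>
      (m.blockVec b z.1, m.blockVec b z.2)) ((gaussianLaw s σ).prod (gaussianLaw t τ)) := by
  have h1 := (m.measurePreserving_blocks s σ).prod (m.measurePreserving_blocks t τ)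
  have h2 := (measurePreserving_arrowProdEquivProdArrow (Fin m.len → ℝ) (Fin m.len → ℝ)
    (Fin m.card) (fun b => gaussianLaw (m.blockVec b s) (m.blockVec b σ))
    (fun b => gaussianLaw (m.blockVec b t) (m.blockVec b τ))).symm
  have h3 := h2.comp h1
  refine (iIndepFun_iff_hasLaw_pi_pi (fun b => ?_)).2 ⟨h3.measurable.aemeasurable, h3.map_eq⟩
  have h4 := (m.measurePreserving_blockVec s σ b).prod (m.measurePreserving_blockVec t τ b)
  exact ⟨h4.measurable.aemeasurable, h4.map_eq⟩

end Model

/-! ### Degrees of freedom and moments on one block. -/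

namespace Model

variable {kn : ℕ}

/-- The assumptions on the variances and on the dimension of a model: `σ₀` is a lower bound of the
variances, `γ σ₀` is an upper bound, and the dimension is small enough. -/
structure Admissible (m : Model kn) (σ : Fin (2 ^ kn) → ℝ) (σ₀ γ θ : ℝ) : Prop where
  pos : 0 < σ₀
  le : ∀ i, σ₀ ≤ σ i
  le_mul : ∀ i, σ i ≤ γ * σ₀
  one_le : 1 ≤ γ
  one_lt : 1 < θ
  dim : θ / (θ - 1) * (γ + 2) * (m.D : ℝ) ≤ (2 ^ kn : ℝ)

/-- The order of the moments used for the projected noise. -/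
noncomputable def order (m : Model kn) : ℕ := ⌊2 * Real.log (1 + (m.d : ℝ))⌋₊ + 1

/-- The dimension of the orthogonal complement of `E_m`. -/
noncomputable def codim (m : Model kn) : ℕ := Module.finrank ℝ m.spaceᗮ

variable {m : Model kn}

/-- With `t = 1 + d`: `2 log t = 4 log √t < 4(√t - 1) ≤ t`, the last step being `(√t - 2)² ≥ 0`. -/
lemma order_le : m.order ≤ m.d + 1 := by
  refine Nat.succ_le_succ (Nat.lt_succ_iff.1 ((Nat.floor_lt' (by omega)).2 ?_))
  have hd : (1 : ℝ) ≤ m.d := by exact_mod_cast m.one_le_finrank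
  set t : ℝ := 1 + (m.d : ℝ) with ht
  have ht0 : 0 < t := by linarith
  have h1 : Real.log t = 2 * Real.log (√t) := by
    rw [Real.log_sqrt ht0.le]; ring
  have h2 : 1 < √t := by
    rw [Real.lt_sqrt (by norm_num)]; linarith
  have h3 := Real.log_lt_sub_one_of_pos (by linarith : 0 < √t) h2.ne'
  have h4 := Real.sq_sqrt ht0.le
  push_cast
  nlinarith [sq_nonneg (√t - 2)]

lemma one_le_d : (1 : ℝ) ≤ m.d := by exact_mod_cast m.one_le_finrank

lemma half_le_log : 1 / 2 ≤ Real.log (1 + (m.d : ℝ)) := by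
  have h := Real.log_two_gt_d9
  have h2 : Real.log 2 ≤ Real.log (1 + (m.d : ℝ)) :=
    Real.log_le_log (by norm_num) (by linarith [m.one_le_d])
  linarith

lemma two_le_order : 2 ≤ m.order := by
  refine Nat.succ_le_succ ((Nat.one_le_floor_iff _).2 ?_)
  linarith [m.half_le_log]

lemma d_add_codim : m.d + m.codim = m.len := by
  have h := m.space.finrank_add_finrank_orthogonal
  rw [finrank_euclideanSpace_fin] at h
  exact h

variable {σ : Fin (2 ^ kn) → ℝ} {σ₀ γ θ : ℝ}

namespace Admissible

/-- By `order_le` and `γ ≥ 1`, `d + 2 order ≤ 3d + 2 ≤ (γ + 2)(d + 1)`, to which the dimension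
hypothesis, divided by the number of blocks, applies. -/
lemma len_bound (h : m.Admissible σ σ₀ γ θ) : (m.d + 2 * m.order) * θ ≤ m.len * (θ - 1) := by
  have hθ : 0 < θ - 1 := by linarith [h.one_lt]
  have hθ0 : 0 < θ := by linarith
  have hc : (0 : ℝ) < m.card := by exact_mod_cast m.card_pos
  have h1 := h.dim
  have h2 : (2 ^ kn : ℝ) = m.card * m.len := by exact_mod_cast m.card_mul_len.symm
  rw [h2, D] at h1
  push_cast at h1
  have h3 : θ / (θ - 1) * (γ + 2) * (m.d + 1) ≤ m.len := by
    refine le_of_mul_le_mul_left ?_ hc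
    linarith
  have h4 : θ * (γ + 2) * (m.d + 1) ≤ m.len * (θ - 1) := by
    rw [div_mul_eq_mul_div, div_mul_eq_mul_div, div_le_iff₀ hθ] at h3
    exact h3
  have h5 : (m.order : ℝ) ≤ m.d + 1 := by exact_mod_cast m.order_le
  have h6 := h.one_le
  have h7 := m.one_le_d
  have h8 : (m.d + 2 * m.order : ℝ) ≤ (γ + 2) * (m.d + 1) := by nlinarith
  nlinarith

/-- Even after removing `2q` degrees of freedom from the residuals, a fraction `1/θ` of the block
length remains. This is how `θ` enters all the moment bounds. -/
lemma len_le (h : m.Admissible σ σ₀ γ θ) {q : ℕ} (hq : q ≤ m.order) :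
    (m.len : ℝ) ≤ θ * (m.codim - 2 * q) := by
  have h1 := h.len_bound
  have h2 : (m.d : ℝ) + m.codim = m.len := by exact_mod_cast m.d_add_codim
  have h3 : (q : ℝ) ≤ m.order := by exact_mod_cast hq
  have h4 := h.one_lt
  have h5 : θ * q ≤ θ * m.order := by gcongr
  nlinarith

lemma lt_codim (h : m.Admissible σ σ₀ γ θ) {q : ℕ} (hq : q ≤ m.order) :
    (q : ℝ) < m.codim / 2 := by
  have h1 := h.len_le hq
  have h2 : (0 : ℝ) < m.len := by exact_mod_cast m.len_pos
  have h3 := h.one_lt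
  have h4 : 0 < (m.codim - 2 * q : ℝ) := by
    by_contra hn
    have := mul_nonpos_of_nonneg_of_nonpos (by linarith : 0 ≤ θ) (not_lt.1 hn)
    linarith
  linarith

lemma var_pos (h : m.Admissible σ σ₀ γ θ) (i : Fin (2 ^ kn)) : 0 < σ i := h.pos.trans_le (h.le i)

end Admissible

@[fun_prop]
lemma measurable_rss (b : Fin m.card) : Measurable (m.rss b) :=
  (measurable_projSq _).comp (m.measurable_blockVec b)

lemma rss_nonneg (b : Fin m.card) (y : Fin (2 ^ kn) → ℝ) : 0 ≤ m.rss b y := projSq_nonneg _ _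

namespace Admissible

lemma lintegral_exp_rss_le (h : m.Admissible σ σ₀ γ θ) (s : Fin (2 ^ kn) → ℝ) (b : Fin m.card)
    (u : ℝ) (hu : 0 ≤ u) :
    ∫⁻ y, ENNReal.ofReal (Real.exp (-(u * m.rss b y))) ∂(gaussianLaw s σ) ≤
      ENNReal.ofReal ((1 + 2 * (u * σ₀)) ^ (-((m.codim : ℝ) / 2))) := by
  have h1 := lintegral_exp_neg_mul_projSq_le m.spaceᗮ (m.blockVec b s) (m.blockVec b σ)
    (fun j => h.var_pos _) h.pos (fun j => h.le _) hu
  rw [← (m.measurePreserving_blockVec s σ b).lintegral_comp (by fun_prop), neg_div] at h1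
  exact h1

lemma ae_rss_pos (h : m.Admissible σ σ₀ γ θ) (s : Fin (2 ^ kn) → ℝ) :
    ∀ᵐ y ∂(gaussianLaw s σ), ∀ b, 0 < m.rss b y := by
  refine ae_all_iff.2 fun b => ae_pos_of_laplace (measurable_rss b) (rss_nonneg b) h.pos ?_
    (h.lintegral_exp_rss_le s b)
  have := h.lt_codim (Nat.zero_le _)
  simpa using this

lemma inv_le (h : m.Admissible σ σ₀ γ θ) {q : ℕ} (hq : q ≤ m.order) :
    (2 * σ₀ * ((m.codim : ℝ) / 2 - q))⁻¹ ≤ θ / σ₀ / m.len := by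
  have h1 := h.len_le hq
  have h2 := h.lt_codim hq
  have h3 : (0 : ℝ) < m.len := by exact_mod_cast m.len_pos
  have h4 := h.pos
  have h5 : 0 < (m.codim : ℝ) / 2 - q := by linarith
  rw [inv_eq_one_div, div_div, div_le_div_iff₀ (by positivity) (by positivity)]
  nlinarith

/-- Up to the chosen order, the negative moments are those of an estimated variance bounded below by
`σ₀/θ`, whatever the mean `s`. -/
lemma lintegral_inv_rss_pow_le (h : m.Admissible σ σ₀ γ θ) (s : Fin (2 ^ kn) → ℝ) (b : Fin m.card)
    {i : ℕ} (hi : i ≤ m.order) :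
    ∫⁻ y, ENNReal.ofReal ((m.len / m.rss b y) ^ i) ∂(gaussianLaw s σ) ≤
      ENNReal.ofReal ((θ / σ₀) ^ i) := by
  have h1 := lintegral_inv_pow_mul_exp_le (measurable_rss b) (rss_nonneg b) h.pos
    (h.lintegral_exp_rss_le s b) m.order (h.lt_codim le_rfl) i hi 0 le_rfl
  simp only [zero_mul, neg_zero, Real.exp_zero, mul_one, mul_zero, add_zero, Real.one_rpow,
    one_mul] at h1
  have h3 : (0 : ℝ) < m.len := by exact_mod_cast m.len_pos
  have hinv0 : 0 ≤ (2 * σ₀ * ((m.codim : ℝ) / 2 - m.order))⁻¹ :=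
    inv_nonneg.2 (mul_nonneg (by linarith [h.pos]) (by linarith [h.lt_codim (le_refl m.order)]))
  calc _ = ENNReal.ofReal ((m.len : ℝ) ^ i) *
        ∫⁻ y, ENNReal.ofReal ((m.rss b y)⁻¹ ^ i) ∂(gaussianLaw s σ) := by
        rw [← lintegral_const_mul' _ _ (by simp)]
        refine lintegral_congr fun y => ?_
        rw [← ENNReal.ofReal_mul (by positivity), ← mul_pow, div_eq_mul_inv]
    _ ≤ ENNReal.ofReal ((m.len : ℝ) ^ i) * ENNReal.ofReal ((θ / σ₀ / m.len) ^ i) := by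
        gcongr
        exact h1.trans (ENNReal.ofReal_le_ofReal (pow_le_pow_left₀ hinv0 (h.inv_le le_rfl) i))
    _ = _ := by
        rw [← ENNReal.ofReal_mul (by positivity), ← mul_pow]
        congr 2
        field_simp

/-- One inverse power costs one unit of the exponent `codim/2`, and `codim/2 - 1 ≥ len/(2θ)`. This
is the rate appearing in `R₂`. -/
lemma lintegral_inv_rss_mul_exp_le (h : m.Admissible σ σ₀ γ θ) (s : Fin (2 ^ kn) → ℝ)
    (b : Fin m.card) {c : ℝ} (hc : 0 ≤ c) :
    ∫⁻ y, ENNReal.ofReal (m.len / m.rss b y * Real.exp (-(c * m.rss b y))) ∂(gaussianLaw s σ) ≤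
      ENNReal.ofReal (θ / σ₀ * Real.exp (-(m.len / (2 * θ)) * Real.log (1 + 2 * (c * σ₀)))) := by
  have ho : 1 ≤ m.order := by linarith [m.two_le_order]
  have h1 := lintegral_inv_pow_mul_exp_le (measurable_rss b) (rss_nonneg b) h.pos
    (h.lintegral_exp_rss_le s b) 1 (h.lt_codim ho) 1 le_rfl c hc
  simp only [pow_one] at h1
  have h3 : (0 : ℝ) < m.len := by exact_mod_cast m.len_pos
  have hp := h.pos
  have hθ := h.one_lt
  have hcσ : 0 ≤ c * σ₀ := by positivity
  have hinv0 : 0 ≤ (2 * σ₀ * ((m.codim : ℝ) / 2 - (1 : ℕ)))⁻¹ :=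
    inv_nonneg.2 (mul_nonneg (by linarith [h.pos]) (by linarith [h.lt_codim ho]))
  calc _ = ENNReal.ofReal (m.len : ℝ) *
        ∫⁻ y, ENNReal.ofReal ((m.rss b y)⁻¹ * Real.exp (-(c * m.rss b y))) ∂(gaussianLaw s σ) := by
        rw [← lintegral_const_mul' _ _ (by simp)]
        refine lintegral_congr fun y => ?_
        rw [← ENNReal.ofReal_mul (by positivity), div_eq_mul_inv, mul_assoc]
    _ ≤ ENNReal.ofReal (m.len : ℝ) *
        ENNReal.ofReal (Real.exp (-(m.len / (2 * θ)) * Real.log (1 + 2 * (c * σ₀))) *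
          (θ / σ₀ / m.len)) := by
        gcongr
        refine h1.trans (ENNReal.ofReal_le_ofReal ?_)
        refine mul_le_mul ?_ (h.inv_le ho) hinv0 (Real.exp_pos _).le
        rw [Real.rpow_def_of_pos (by linarith), mul_comm (Real.log _)]
        refine Real.exp_le_exp.2 (mul_le_mul_of_nonneg_right ?_ (Real.log_nonneg (by linarith)))
        rw [neg_le_neg_iff, div_le_iff₀ (by positivity)]
        have := h.len_le ho
        push_cast at this ⊢
        linarith
    _ = _ := by
        rw [← ENNReal.ofReal_mul (by positivity)]
        congr 1
        field_simp

lemma lintegral_projSq_pow_le (h : m.Admissible σ σ₀ γ θ) (b : Fin m.card) {i : ℕ} (hi : 1 ≤ i)  :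
    ∫⁻ e, ENNReal.ofReal (projSq m.space (m.blockVec b e) ^ i) ∂(gaussianLaw 0 σ) ≤
      ENNReal.ofReal ((γ * σ₀ * (m.d + 2 * i)) ^ i) := by
  have hγ : 0 < γ := by linarith [h.one_le]
  have hd : (0 : ℝ) < m.d := by linarith [m.one_le_d]
  refine lintegral_pow_le (W := fun e => projSq m.space (m.blockVec b e))
    (fun e => projSq_nonneg _ _) (mul_pos hγ h.pos) hd (fun t ht ht1 => ?_) i hi
  have h1 := lintegral_exp_mul_projSq_le m.space (m.blockVec b σ)
    (fun j => h.var_pos _) (fun j => h.le_mul _) ht ht1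
  have h2 := (m.measurePreserving_blockVec 0 σ b).lintegral_comp
    (f := fun e => ENNReal.ofReal (Real.exp (t * projSq m.space e))) (by fun_prop)
  rw [h2]
  exact h1

lemma lintegral_projSq_le (h : m.Admissible σ σ₀ γ θ) (b : Fin m.card) :
    ∫⁻ e, ENNReal.ofReal (projSq m.space (m.blockVec b e)) ∂(gaussianLaw 0 σ) ≤
      ENNReal.ofReal (γ * σ₀ * m.d) := by
  have h1 := HeteroGauss.lintegral_projSq_le m.space (m.blockVec b σ)
    (fun j => h.var_pos _) (fun j => h.le_mul _)
  have h2 := (m.measurePreserving_blockVec 0 σ b).lintegral_comp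
    (f := fun e => ENNReal.ofReal (projSq m.space e)) (by fun_prop)
  rw [h2]
  exact h1

end Admissible

lemma measurable_noise (b : Fin m.card) :
    Measurable fun z : (Fin (2 ^ kn) → ℝ) × (Fin (2 ^ kn) → ℝ) => m.noise b z.1 z.2 := by
  unfold noise
  have h1 : Measurable fun z : (Fin (2 ^ kn) → ℝ) × (Fin (2 ^ kn) → ℝ) => m.rss b z.2 :=
    (measurable_rss b).comp measurable_snd
  have h2 : Measurable fun z : (Fin (2 ^ kn) → ℝ) × (Fin (2 ^ kn) → ℝ) =>
      projSq m.space (m.blockVec b z.1) :=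
    ((measurable_projSq _).comp (m.measurable_blockVec b)).comp measurable_fst
  exact h2.mul (h1.const_div _)

lemma noise_nonneg (b : Fin m.card) (e y : Fin (2 ^ kn) → ℝ) : 0 ≤ m.noise b e y :=
  mul_nonneg (projSq_nonneg _ _) (div_nonneg (Nat.cast_nonneg _) (rss_nonneg _ _))

lemma iIndepFun_noise (s t σ τ : Fin (2 ^ kn) → ℝ) :
    iIndepFun (fun b (z : (Fin (2 ^ kn) → ℝ) × (Fin (2 ^ kn) → ℝ)) => m.noise b z.1 z.2)
      ((gaussianLaw s σ).prod (gaussianLaw t τ)) := by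
  refine (m.iIndepFun_blocks s σ t τ).comp
    (fun _ w => projSq m.space w.1 * (m.len / projSq m.spaceᗮ w.2)) fun b => ?_
  have h1 : Measurable fun w : (Fin m.len → ℝ) × (Fin m.len → ℝ) => projSq m.space w.1 :=
    (measurable_projSq _).comp measurable_fst
  have h2 : Measurable fun w : (Fin m.len → ℝ) × (Fin m.len → ℝ) => projSq m.spaceᗮ w.2 :=
    (measurable_projSq _).comp measurable_snd
  exact h1.mul (h2.const_div _)

namespace Admissible

/-- Projection and residual come from independent samples, so the moment factors; the unknown scale
`σ₀` cancels. -/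
lemma lintegral_noise_pow_le (h : m.Admissible σ σ₀ γ θ) (s : Fin (2 ^ kn) → ℝ) (b : Fin m.card)
    {i : ℕ} (hi1 : 1 ≤ i) (hi : i ≤ m.order) :
    ∫⁻ z, ENNReal.ofReal (m.noise b z.1 z.2 ^ i) ∂((gaussianLaw 0 σ).prod (gaussianLaw s σ)) ≤
      ENNReal.ofReal ((γ * θ * (m.d + 2 * m.order)) ^ i) := by
  have hp := h.pos
  have hγ : 0 < γ := by linarith [h.one_le]
  have hθ : 0 < θ := by linarith [h.one_lt]
  have h1 : ∀ z : (Fin (2 ^ kn) → ℝ) × (Fin (2 ^ kn) → ℝ),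
      ENNReal.ofReal (m.noise b z.1 z.2 ^ i) =
      ENNReal.ofReal (projSq m.space (m.blockVec b z.1) ^ i) *
        ENNReal.ofReal ((m.len / m.rss b z.2) ^ i) := by
    intro z
    rw [← ENNReal.ofReal_mul (pow_nonneg (projSq_nonneg _ _) _), ← mul_pow, noise]
  simp_rw [h1]
  have hm1 : Measurable fun e : Fin (2 ^ kn) → ℝ => projSq m.space (m.blockVec b e) :=
    (measurable_projSq _).comp (m.measurable_blockVec b)
  have hm2 := m.measurable_rss b
  rw [lintegral_prod_mul (f := fun e => ENNReal.ofReal (projSq m.space (m.blockVec b e) ^ i))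
    (g := fun y => ENNReal.ofReal ((m.len / m.rss b y) ^ i))
    (Measurable.aemeasurable (by fun_prop)) (Measurable.aemeasurable (by fun_prop))]
  refine (mul_le_mul' (h.lintegral_projSq_pow_le b hi1) (h.lintegral_inv_rss_pow_le s b hi)).trans ?_
  rw [← ENNReal.ofReal_mul (by positivity), ← mul_pow]
  refine ENNReal.ofReal_le_ofReal (pow_le_pow_left₀ (by positivity) ?_ i)
  have h2 : (i : ℝ) ≤ m.order := by exact_mod_cast hi
  have h3 : γ * σ₀ * (m.d + 2 * i) * (θ / σ₀) = γ * θ * (m.d + 2 * i) := by field_simp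
  rw [h3]
  gcongr

lemma lintegral_noise_le (h : m.Admissible σ σ₀ γ θ) (s : Fin (2 ^ kn) → ℝ) (b : Fin m.card) :
    ∫⁻ z, ENNReal.ofReal (m.noise b z.1 z.2) ∂((gaussianLaw 0 σ).prod (gaussianLaw s σ)) ≤
      ENNReal.ofReal (γ * θ * m.d) := by
  have hp := h.pos
  have hγ : 0 < γ := by linarith [h.one_le]
  have hθ : 0 < θ := by linarith [h.one_lt]
  have h1 : ∀ z : (Fin (2 ^ kn) → ℝ) × (Fin (2 ^ kn) → ℝ),
      ENNReal.ofReal (m.noise b z.1 z.2) =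
      ENNReal.ofReal (projSq m.space (m.blockVec b z.1)) *
        ENNReal.ofReal (m.len / m.rss b z.2) := by
    intro z
    rw [← ENNReal.ofReal_mul (projSq_nonneg _ _), noise]
  simp_rw [h1]
  have hm1 : Measurable fun e : Fin (2 ^ kn) → ℝ => projSq m.space (m.blockVec b e) :=
    (measurable_projSq _).comp (m.measurable_blockVec b)
  have hm2 := m.measurable_rss b
  rw [lintegral_prod_mul (f := fun e => ENNReal.ofReal (projSq m.space (m.blockVec b e)))
    (g := fun y => ENNReal.ofReal (m.len / m.rss b y))
    (Measurable.aemeasurable (by fun_prop)) (Measurable.aemeasurable (by fun_prop))]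
  have h2 := h.lintegral_inv_rss_pow_le s b (i := 1) (by linarith [m.two_le_order])
  simp only [pow_one] at h2
  refine (mul_le_mul' (h.lintegral_projSq_le b) h2).trans ?_
  rw [← ENNReal.ofReal_mul (by positivity)]
  refine ENNReal.ofReal_le_ofReal (le_of_eq ?_)
  field_simp

end Admissible

end Model

/-! ### Comparison of the noise with the remainder `R₁`. -/

/-- The comparison of moments needs only `C² ≥ 1800`. -/
lemma le_constC : 43 ≤ constC := by
  have he : Real.exp 1 < 1.65 ^ 2 := by have := Real.exp_one_lt_d9; norm_num at this ⊢; linarith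
  have he1 : (1.6 : ℝ) ^ 2 < Real.exp 1 := by have := Real.exp_one_gt_d9; norm_num at this ⊢; linarith
  have h1 : √(Real.exp 1) < 1.65 := (Real.sqrt_lt' (by norm_num)).2 he
  have h2 : 1.6 < √(Real.exp 1) := Real.lt_sqrt_of_sq_lt he1
  have h3 : (1.4142 : ℝ) < √2 := Real.lt_sqrt_of_sq_lt (by norm_num)
  unfold constC
  rw [Real.sqrt_mul (by norm_num), le_div_iff₀ (by linarith)]
  nlinarith [mul_lt_mul_of_pos_right h3 (by linarith : 0 < √(Real.exp 1))]

namespace Model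

variable {kn : ℕ} {m : Model kn}

/-- Comparison of the moment bound with the corresponding term of the remainder. -/
lemma moment_bound_le {γ θ x : ℝ} (hγ : 1 ≤ γ) (hθ : 1 < θ) (hx : 0 < x) :
    (√(3 * m.order * m.card) * (√2 * (γ * θ * (m.d + 2 * m.order)))) ^ m.order /
        (x / 2) ^ (m.order - 1) ≤
      constC * θ ^ 2 * γ * (√(m.card : ℝ) * (m.d : ℝ) *
        (2 * constC * θ ^ 2 * γ * √(m.card : ℝ) * (m.d : ℝ) * Real.log (1 + (m.d : ℝ)) / x) ^
          ⌊2 * Real.log (1 + (m.d : ℝ))⌋₊) := by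
  obtain ⟨L, hL⟩ : ∃ L, L = Real.log (1 + (m.d : ℝ)) := ⟨_, rfl⟩
  obtain ⟨k, hk⟩ : ∃ k, k = ⌊2 * Real.log (1 + (m.d : ℝ))⌋₊ := ⟨_, rfl⟩
  have hq : m.order = k + 1 := by rw [order, hk]
  have hkd : k ≤ m.d := by have := m.order_le; omega
  have hk1 : 1 ≤ k := by have := m.two_le_order; omega
  have hLhalf : 1 / 2 ≤ L := hL ▸ m.half_le_log
  have hkL : (k : ℝ) ≤ 2 * L := by
    rw [hk, ← hL]; exact Nat.floor_le (by linarith)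
  have hC := le_constC
  have hd := m.one_le_d
  have hkd' : (k : ℝ) ≤ m.d := by exact_mod_cast hkd
  have hp : (0 : ℝ) < m.card := by exact_mod_cast m.card_pos
  rw [← hk, ← hL, hq, Nat.add_sub_cancel]
  set C := constC
  set d : ℝ := (m.d : ℝ)
  set p : ℝ := (m.card : ℝ)
  have hC0 : 0 < C := by linarith
  set T : ℝ := θ ^ 2 * γ * √p * d with hT
  have hT0 : 0 < T := by positivity
  have hrhs : C * θ ^ 2 * γ * (√p * d * (2 * C * θ ^ 2 * γ * √p * d * L / x) ^ k) =
      (C * T) ^ (k + 1) * L ^ k / (x / 2) ^ k := by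
    rw [show 2 * C * θ ^ 2 * γ * √p * d * L / x = (C * T) * L / (x / 2) by
      rw [hT]; field_simp, div_pow, mul_pow (C * T) L, hT]
    ring
  rw [hrhs]
  refine div_le_div_of_nonneg_right ?_ (by positivity)
  -- From `k ≤ d` and `1 ≤ d`, `d + 2(k + 1) ≤ 5d`.
  have hbase : √(3 * ((k + 1 : ℕ) : ℝ) * p) * (√2 * (γ * θ * (d + 2 * ((k + 1 : ℕ) : ℝ)))) ≤
      √(6 * (k + 1)) * 5 * T := by
    have h1 : √(3 * ((k + 1 : ℕ) : ℝ) * p) * √2 = √(6 * (k + 1)) * √p := by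
      rw [← Real.sqrt_mul (by positivity), ← Real.sqrt_mul (by positivity)]
      congr 1; push_cast; ring
    have h2 : d + 2 * ((k + 1 : ℕ) : ℝ) ≤ 5 * d := by push_cast; linarith
    have h3 : γ * θ ≤ γ * θ ^ 2 := by
      refine mul_le_mul_of_nonneg_left ?_ (by linarith); nlinarith
    calc _ = (√(3 * ((k + 1 : ℕ) : ℝ) * p) * √2) * (γ * θ * (d + 2 * ((k + 1 : ℕ) : ℝ))) := by ring
      _ ≤ (√(6 * (k + 1)) * √p) * (γ * θ ^ 2 * (5 * d)) := by rw [h1]; gcongr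
      _ = _ := by rw [hT]; ring
  have hpow := pow_le_pow_left₀ (by positivity) hbase (k + 1)
  refine hpow.trans ?_
  rw [mul_pow, mul_pow C T, mul_right_comm]
  refine mul_le_mul_of_nonneg_right ?_ (by positivity)
  -- After squaring, the claim is `(150(k+1))^(k+1) ≤ C^(2(k+1)) L^(2k)`. It follows from `k + 1 ≤
  -- 2L + 1 ≤ 4L`, which gives `150(k+1) ≤ C²L/3`, and from `(L/3)^(k+1) ≤ L^(2k)`.
  refine (sq_le_sq₀ (by positivity) (by positivity)).1 ?_
  have h4 : (√(6 * ((k : ℝ) + 1)) * 5) ^ 2 = 150 * (k + 1) := by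
    rw [mul_pow, Real.sq_sqrt (by positivity)]; ring
  rw [← pow_mul, mul_comm (k + 1) 2, pow_mul, h4]
  have h5 : 150 * ((k : ℝ) + 1) ≤ C ^ 2 / 3 * L := by
    have : 43 ^ 2 ≤ C ^ 2 := by gcongr
    nlinarith
  calc (150 * ((k : ℝ) + 1)) ^ (k + 1) ≤ (C ^ 2 / 3 * L) ^ (k + 1) := by gcongr
    _ = (C ^ (k + 1)) ^ 2 * (L ^ (k + 1) / 3 ^ (k + 1)) := by
        rw [mul_pow, div_pow, ← pow_mul, ← pow_mul, mul_comm 2 (k + 1)]; ring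
    _ ≤ (C ^ (k + 1)) ^ 2 * (L ^ k) ^ 2 := by
        refine mul_le_mul_of_nonneg_left ?_ (by positivity)
        rw [div_le_iff₀ (by positivity)]
        obtain ⟨l, rfl⟩ : ∃ l, k = l + 1 := ⟨k - 1, by omega⟩
        have h6 : 1 ≤ (3 * L) ^ l := one_le_pow₀ (by linarith)
        calc L ^ (l + 1 + 1) = L ^ (l + 2) * 1 := by ring
          _ ≤ L ^ (l + 2) * ((3 * L) ^ l * 9) := by gcongr; linarith
          _ = (L ^ (l + 1)) ^ 2 * 3 ^ (l + 1 + 1) := by rw [mul_pow]; ring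
    _ = _ := by ring

/-- The mean excess of the projected noise. -/
lemma Admissible.lintegral_noise_excess_le {σ : Fin (2 ^ kn) → ℝ} {σ₀ γ θ : ℝ}
    (h : m.Admissible σ σ₀ γ θ) (s : Fin (2 ^ kn) → ℝ) {x : ℝ} (hx : 0 < x) :
    ∫⁻ z, ENNReal.ofReal (∑ b, m.noise b z.1 z.2 - γ * θ * m.D - x / 2)
        ∂((gaussianLaw 0 σ).prod (gaussianLaw s σ)) ≤
      ENNReal.ofReal (constC * θ ^ 2 * γ * (√(m.card : ℝ) * (m.d : ℝ) *
        (2 * constC * θ ^ 2 * γ * √(m.card : ℝ) * (m.d : ℝ) * Real.log (1 + (m.d : ℝ)) / x) ^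
          ⌊2 * Real.log (1 + (m.d : ℝ))⌋₊)) := by
  have hγ : 0 < γ := by linarith [h.one_le]
  have hθ : 0 < θ := by linarith [h.one_lt]
  have hd := m.one_le_d
  have h1 := lintegral_sum_sub_le (fun b => m.measurable_noise b)
    (fun b z => m.noise_nonneg b z.1 z.2) (m.iIndepFun_noise 0 s σ σ) m.two_le_order
    (A := γ * θ * (m.d + 2 * m.order)) (a := γ * θ * m.d) (h := x / 2) (by positivity)
    (by positivity) (by positivity) (h.lintegral_noise_le s)
    (fun b j hj1 hj => h.lintegral_noise_pow_le s b hj1 hj)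
  rw [Fintype.card_fin] at h1
  refine le_trans (lintegral_mono fun z => ENNReal.ofReal_le_ofReal ?_)
    (h1.trans (ENNReal.ofReal_le_ofReal (moment_bound_le h.one_le h.one_lt hx)))
  have : (m.D : ℝ) = m.card * (m.d + 1) := by unfold D; push_cast; ring
  rw [this]
  -- The penalty counts `d + 1` per block, the mean of the noise only `d`; the difference is
  -- discarded.
  have h3 : 0 ≤ γ * θ * m.card := by positivity
  linarith

end Model

/-! ### Fluctuations and the remainder `R₂`. -/

namespace Model

variable {kn : ℕ} {m : Model kn} {σ : Fin (2 ^ kn) → ℝ} {σ₀ γ θ : ℝ}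

lemma measurable_varEst (i : Fin (2 ^ kn)) : Measurable fun y => m.varEst y i := by
  simp_rw [varEst_eq]
  exact (measurable_rss _).div_const _

lemma varEst_pos {y : Fin (2 ^ kn) → ℝ} (hy : ∀ b, 0 < m.rss b y) (i : Fin (2 ^ kn)) :
    0 < m.varEst y i := by
  rw [varEst_eq]; exact div_pos (hy _) (by exact_mod_cast m.len_pos)

lemma measurable_proj (i : Fin (2 ^ kn)) : Measurable fun y => m.proj y i := by
  unfold proj
  have : Continuous fun y : Fin (2 ^ kn) → ℝ => WithLp.toLp 2 y := PiLp.continuous_toLp 2 _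
  exact Continuous.measurable (by fun_prop)

lemma measurable_fluct (s : Fin (2 ^ kn) → ℝ) :
    Measurable fun z : (Fin (2 ^ kn) → ℝ) × (Fin (2 ^ kn) → ℝ) => m.fluct s σ z.1 z.2 := by
  unfold fluct
  have h1 : ∀ i, Measurable fun z : (Fin (2 ^ kn) → ℝ) × (Fin (2 ^ kn) → ℝ) => m.varEst z.2 i :=
    fun i => (m.measurable_varEst i).comp measurable_snd
  have h2 : ∀ i, Measurable fun z : (Fin (2 ^ kn) → ℝ) × (Fin (2 ^ kn) → ℝ) => z.1 i :=
    fun i => (measurable_pi_apply i).comp measurable_fst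
  fun_prop

lemma measurable_bias (s : Fin (2 ^ kn) → ℝ) : Measurable fun y => m.bias s σ y := by
  unfold bias
  have h1 := m.measurable_varEst
  fun_prop

lemma measurable_lossReal (s : Fin (2 ^ kn) → ℝ) :
    Measurable fun z : (Fin (2 ^ kn) → ℝ) × (Fin (2 ^ kn) → ℝ) => m.lossReal s σ z.1 z.2 := by
  unfold lossReal
  have h1 : ∀ i, Measurable fun z : (Fin (2 ^ kn) → ℝ) × (Fin (2 ^ kn) → ℝ) => m.varEst z.2 i :=
    fun i => (m.measurable_varEst i).comp measurable_snd
  have h2 : ∀ i, Measurable fun z : (Fin (2 ^ kn) → ℝ) × (Fin (2 ^ kn) → ℝ) =>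
      m.proj (s + z.1) i :=
    fun i => (m.measurable_proj i).comp (measurable_fst.const_add s)
  fun_prop

/-- The exponential moment of the fluctuations compensated by a fraction of the loss, when the
second sample is fixed. -/
lemma lintegral_exp_fluct_le_one (hσ : ∀ i, 0 < σ i) {α lam : ℝ} (hα1 : α < 1) (hl : 0 < lam)
    (hlα : lam ≤ α) (s : Fin (2 ^ kn) → ℝ) {y : Fin (2 ^ kn) → ℝ} (hy : ∀ b, 0 < m.rss b y)
    (hlr : ∀ i, lam * (σ i / m.varEst y i) ≤ α) :
    ∫⁻ e, ENNReal.ofReal (Real.exp (lam * (m.fluct s σ e y - α * m.bias s σ y)))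
      ∂(gaussianLaw 0 σ) ≤ 1 := by
  have h1 : ∀ e : Fin (2 ^ kn) → ℝ,
      ENNReal.ofReal (Real.exp (lam * (m.fluct s σ e y - α * m.bias s σ y))) =
      ∏ i, ENNReal.ofReal (Real.exp (lam * ((1 / 2) * ((1 - σ i / m.varEst y i) *
        (e i ^ 2 / σ i - 1)) - e i * (s i - m.proj s i) / m.varEst y i -
      α / 2 * ((s i - m.proj s i) ^ 2 / m.varEst y i +
        (Real.log (m.varEst y i / σ i) + 1 / (m.varEst y i / σ i) - 1))))) := by
    intro e
    rw [← ENNReal.ofReal_prod_of_nonneg fun _ _ => (Real.exp_pos _).le, ← Real.exp_sum,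
      ← Finset.mul_sum, Finset.sum_sub_distrib, ← Finset.mul_sum _ _ (α / 2), fluct, bias]
    congr 3
    ring
  simp_rw [h1, gaussianLaw]
  rw [lintegral_pi_prod_eq_prod _ (fun i x => ENNReal.ofReal (Real.exp (lam * ((1 / 2) *
    ((1 - σ i / m.varEst y i) * (x ^ 2 / σ i - 1)) - x * (s i - m.proj s i) / m.varEst y i -
      α / 2 * ((s i - m.proj s i) ^ 2 / m.varEst y i +
        (Real.log (m.varEst y i / σ i) + 1 / (m.varEst y i / σ i) - 1))))))
    (fun _ => by fun_prop)]
  refine Finset.prod_le_one' fun i _ => ?_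
  exact lintegral_exp_coord_le_one _ hα1 hl hlα (hσ i) (varEst_pos hy i) (hlr i)

/-- The mean excess of the fluctuations when the second sample is fixed. -/
lemma Admissible.lintegral_fluct_sub_le (h : m.Admissible σ σ₀ γ θ) {α x : ℝ} (hα : 0 < α)
    (hα1 : α < 1) (s : Fin (2 ^ kn) → ℝ) {y : Fin (2 ^ kn) → ℝ} (hy : ∀ b, 0 < m.rss b y) :
    ∫⁻ e, ENNReal.ofReal (m.fluct s σ e y - α * m.bias s σ y - x / 4) ∂(gaussianLaw 0 σ) ≤
      ENNReal.ofReal (1 / α) * (ENNReal.ofReal (Real.exp (-(α * x / 4))) +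
        ∑ b, ENNReal.ofReal (γ * σ₀) * ENNReal.ofReal (m.len / m.rss b y *
          Real.exp (-(α * x / (4 * γ * σ₀ * m.len) * m.rss b y)))) := by
  have hγ : 0 < γ := by linarith [h.one_le]
  have hσ₀ := h.pos
  have hlen : (0 : ℝ) < m.len := by exact_mod_cast m.len_pos
  -- a bound valid for every admissible value of the scale `V`
  have key : ∀ V : ℝ, 1 ≤ V → (∀ b, γ * σ₀ * m.len / m.rss b y ≤ V) →
      ∫⁻ e, ENNReal.ofReal (m.fluct s σ e y - α * m.bias s σ y - x / 4) ∂(gaussianLaw 0 σ) ≤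
        ENNReal.ofReal (1 / α) * ENNReal.ofReal (V * Real.exp (-(α * x / (4 * V)))) := by
    intro V hV hVb
    have hV0 : 0 < V := by linarith
    -- With `λ = α/V`, the bound `V ≥ 1` gives `λ ≤ α`, and `σ_i/σ̂_i ≤ V` gives `λσ_i/σ̂_i ≤ α`.
    have h1 := lintegral_exp_fluct_le_one (m := m) h.var_pos hα1 (lam := α / V) (by positivity)
      ((div_le_iff₀ hV0).2 (by nlinarith)) s hy (fun i => by
        have h2 : σ i / m.varEst y i ≤ V := by
          refine le_trans ?_ (hVb (m.block i))
          rw [varEst_eq, div_div_eq_mul_div]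
          have := h.le_mul i
          have := hy (m.block i)
          gcongr
        calc α / V * (σ i / m.varEst y i) ≤ α / V * V := by gcongr
          _ = α := by field_simp)
    have h3 : ∀ e, ENNReal.ofReal (m.fluct s σ e y - α * m.bias s σ y - x / 4) ≤
        ENNReal.ofReal (1 / α) * ENNReal.ofReal (V * Real.exp (-(α * x / (4 * V)))) *
          ENNReal.ofReal (Real.exp (α / V * (m.fluct s σ e y - α * m.bias s σ y))) := by
      intro e
      rw [← ENNReal.ofReal_mul (by positivity), ← ENNReal.ofReal_mul (by positivity)]
      refine ENNReal.ofReal_le_ofReal ?_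
      set w := m.fluct s σ e y - α * m.bias s σ y
      have h4 : α / V * (w - x / 4) ≤ Real.exp (α / V * (w - x / 4)) := by
        have := Real.add_one_le_exp (α / V * (w - x / 4)); linarith
      have h5 : 1 / α * (V * Real.exp (-(α * x / (4 * V)))) * Real.exp (α / V * w) =
          V / α * Real.exp (α / V * (w - x / 4)) := by
        rw [show α / V * (w - x / 4) = -(α * x / (4 * V)) + α / V * w by field_simp; ring,
          Real.exp_add]
        ring
      rw [h5]
      calc w - x / 4 = V / α * (α / V * (w - x / 4)) := by field_simp
        _ ≤ _ := by gcongr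
    calc _ ≤ ∫⁻ e, ENNReal.ofReal (1 / α) * ENNReal.ofReal (V * Real.exp (-(α * x / (4 * V)))) *
          ENNReal.ofReal (Real.exp (α / V * (m.fluct s σ e y - α * m.bias s σ y)))
            ∂(gaussianLaw 0 σ) := lintegral_mono h3
      _ = _ := lintegral_const_mul' _ _ (by finiteness)
      _ ≤ ENNReal.ofReal (1 / α) * ENNReal.ofReal (V * Real.exp (-(α * x / (4 * V)))) * 1 := by
          gcongr
      _ = _ := mul_one _
  have : Nonempty (Fin m.card) := ⟨⟨0, m.card_pos⟩⟩
  obtain ⟨b, hb⟩ := Finite.exists_max fun b => γ * σ₀ * m.len / m.rss b y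
  -- The scale used is the larger of `1` and the maximal ratio over the blocks. Bounding that
  -- maximum by a sum over blocks makes the result integrable term by term in the second sample.
  rcases le_total (γ * σ₀ * m.len / m.rss b y) 1 with h1 | h1
  · refine (key 1 le_rfl fun b' => (hb b').trans h1).trans ?_
    gcongr
    simp
  · refine (key _ h1 hb).trans ?_
    gcongr
    refine le_trans ?_ (le_add_of_nonneg_left zero_le)
    refine le_trans (le_of_eq ?_) (Finset.single_le_sum
      (f := fun b => ENNReal.ofReal (γ * σ₀) * ENNReal.ofReal (m.len / m.rss b y *
          Real.exp (-(α * x / (4 * γ * σ₀ * m.len) * m.rss b y))))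
      (fun _ _ => zero_le) (Finset.mem_univ b))
    rw [← ENNReal.ofReal_mul (by positivity), ← mul_assoc, ← mul_div_assoc]
    have := hy b
    rw [show α * x / (4 * (γ * σ₀ * m.len) / m.rss b y) =
      α * x / (4 * γ * σ₀ * m.len) * m.rss b y by field_simp,
      mul_div_assoc (γ * σ₀)]

/-- The mean excess of the fluctuations. -/
lemma Admissible.lintegral_fluct_excess_le (h : m.Admissible σ σ₀ γ θ) {α x : ℝ} (hα : 0 < α)
    (hα1 : α < 1) (hx : 0 < x) (s : Fin (2 ^ kn) → ℝ) :
    ∫⁻ z, ENNReal.ofReal (m.fluct s σ z.1 z.2 - α * m.bias s σ z.2 - x / 4)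
        ∂((gaussianLaw 0 σ).prod (gaussianLaw s σ)) ≤
      ENNReal.ofReal ((2 * (α + γ * θ) + 1) / α * ((m.card : ℝ) *
        Real.exp (-((2 ^ kn : ℝ) / (2 * θ * (m.card : ℝ))) *
          Real.log (1 + α * (m.card : ℝ) * x / (γ * (2 ^ kn : ℝ) * (α + 2)))))) := by
  have hγ : 0 < γ := by linarith [h.one_le]
  have hθ : 0 < θ := by linarith [h.one_lt]
  have hσ₀ := h.pos
  have hlen : (0 : ℝ) < m.len := by exact_mod_cast m.len_pos
  have hcard : (1 : ℝ) ≤ m.card := by exact_mod_cast m.card_pos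
  have hn : (2 ^ kn : ℝ) = m.card * m.len := by exact_mod_cast m.card_mul_len.symm
  set w : ℝ := α * x / (γ * m.len * (α + 2)) with hw
  have hw0 : 0 < w := by positivity
  set R : ℝ := Real.exp (-(m.len / (2 * θ)) * Real.log (1 + w)) with hR
  have hR0 : 0 < R := Real.exp_pos _
  have hRterm : Real.exp (-((2 ^ kn : ℝ) / (2 * θ * (m.card : ℝ))) *
      Real.log (1 + α * (m.card : ℝ) * x / (γ * (2 ^ kn : ℝ) * (α + 2)))) = R := by
    have h1 : (2 ^ kn : ℝ) / (2 * θ * m.card) = m.len / (2 * θ) := by rw [hn]; field_simp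
    have h2 : α * m.card * x / (γ * (2 ^ kn : ℝ) * (α + 2)) = w := by rw [hn, hw]; field_simp
    rw [h1, h2]
  rw [hRterm]
  -- From `log(1 + w) ≤ w` and `θγ(α + 2) ≥ 2`.
  have hfirst : Real.exp (-(α * x / 4)) ≤ R := by
    refine Real.exp_le_exp.2 ?_
    rw [neg_mul, neg_le_neg_iff]
    have h1 : Real.log (1 + w) ≤ w := by
      have := Real.log_le_sub_one_of_pos (by linarith : 0 < 1 + w); linarith
    calc m.len / (2 * θ) * Real.log (1 + w) ≤ m.len / (2 * θ) * w := by gcongr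
      _ = α * x / (2 * (θ * (γ * (α + 2)))) := by rw [hw]; field_simp
      _ ≤ α * x / 4 := by
          have h2 : 1 ≤ θ * γ := by nlinarith [h.one_le, h.one_lt]
          refine div_le_div_of_nonneg_left (by positivity) (by norm_num) ?_
          nlinarith
  set c : ℝ := α * x / (4 * γ * σ₀ * m.len) with hc
  have hc0 : 0 ≤ c := by positivity
  have hblock : ∀ b, ∫⁻ y, ENNReal.ofReal (m.len / m.rss b y * Real.exp (-(c * m.rss b y)))
      ∂(gaussianLaw s σ) ≤ ENNReal.ofReal (θ / σ₀ * R) := by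
    intro b
    refine (h.lintegral_inv_rss_mul_exp_le s b hc0).trans (ENNReal.ofReal_le_ofReal ?_)
    refine mul_le_mul_of_nonneg_left (Real.exp_le_exp.2 ?_) (by positivity)
    rw [neg_mul, neg_mul, neg_le_neg_iff]
    refine mul_le_mul_of_nonneg_left (Real.log_le_log (by linarith) ?_) (by positivity)
    -- `2cσ₀ = αx/(2γ len)` exceeds `w`, whose denominator has `α + 2` in place of `2`.
    have h1 : 2 * (c * σ₀) = α * x / (γ * m.len * 2) := by rw [hc]; field_simp; ring
    rw [h1, hw]
    gcongr
    linarith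
  have hmeas : ∀ b, Measurable fun y => ENNReal.ofReal (m.len / m.rss b y *
      Real.exp (-(c * m.rss b y))) := fun b => by
    have := m.measurable_rss b
    fun_prop
  rw [lintegral_prod_symm]
  swap
  · have h1 := m.measurable_fluct (σ := σ) s
    have h2 : Measurable fun z : (Fin (2 ^ kn) → ℝ) × (Fin (2 ^ kn) → ℝ) => m.bias s σ z.2 :=
      (m.measurable_bias s).comp measurable_snd
    exact Measurable.aemeasurable (by fun_prop)
  calc _ ≤ ∫⁻ y, ENNReal.ofReal (1 / α) * (ENNReal.ofReal (Real.exp (-(α * x / 4))) +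
        ∑ b, ENNReal.ofReal (γ * σ₀) * ENNReal.ofReal (m.len / m.rss b y *
          Real.exp (-(c * m.rss b y)))) ∂(gaussianLaw s σ) := by
        refine lintegral_mono_ae ?_
        filter_upwards [h.ae_rss_pos s] with y hy
        exact h.lintegral_fluct_sub_le hα hα1 s hy
    _ = ENNReal.ofReal (1 / α) * (ENNReal.ofReal (Real.exp (-(α * x / 4))) +
        ∑ b, ENNReal.ofReal (γ * σ₀) * ∫⁻ y, ENNReal.ofReal (m.len / m.rss b y *
          Real.exp (-(c * m.rss b y))) ∂(gaussianLaw s σ)) := by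
        rw [lintegral_const_mul' _ _ (by simp), lintegral_add_left measurable_const,
          lintegral_const, measure_univ, mul_one,
          lintegral_finsetSum _ fun b _ => (hmeas b).const_mul _]
        congr 3 with b
        exact lintegral_const_mul' _ _ (by simp)
    _ ≤ ENNReal.ofReal (1 / α) * (ENNReal.ofReal R +
        ∑ _b : Fin m.card, ENNReal.ofReal (γ * σ₀) * ENNReal.ofReal (θ / σ₀ * R)) := by
        gcongr with b _
        exact hblock b
    _ ≤ _ := by
        rw [Finset.sum_const, Finset.card_univ, Fintype.card_fin, nsmul_eq_mul,
          ← ENNReal.ofReal_natCast, ← ENNReal.ofReal_mul (by positivity),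
          ← ENNReal.ofReal_mul (by positivity), ← ENNReal.ofReal_add (by positivity) (by positivity),
          ← ENNReal.ofReal_mul (by positivity)]
        refine ENNReal.ofReal_le_ofReal ?_
        have h1 : γ * σ₀ * (θ / σ₀ * R) = γ * θ * R := by field_simp
        rw [h1, div_mul_eq_mul_div, one_mul, div_mul_eq_mul_div]
        refine div_le_div_of_nonneg_right ?_ hα.le
        have h2 : R ≤ m.card * R := le_mul_of_one_le_left hR0.le hcard
        have h3 : 0 ≤ (γ * θ + 2 * α) * (m.card * R) := by positivity
        linarith

lemma integrable_coord_sq (hσ : ∀ i, 0 < σ i) (i : Fin (2 ^ kn)) :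
    Integrable (fun e : Fin (2 ^ kn) → ℝ => e i ^ 2 / σ i - 1) (gaussianLaw 0 σ) ∧
      ∫ e, (e i ^ 2 / σ i - 1) ∂(gaussianLaw 0 σ) = 0 ∧
    Integrable (fun e : Fin (2 ^ kn) → ℝ => e i) (gaussianLaw 0 σ) ∧
      ∫ e, e i ∂(gaussianLaw 0 σ) = 0 := by
  have hmp : MeasurePreserving (fun e : Fin (2 ^ kn) → ℝ => e i) (gaussianLaw 0 σ)
      (gaussianReal 0 (σ i).toNNReal) := measurePreserving_eval _ i
  have h1 : Integrable (fun x : ℝ => (x - 0) ^ 2 / σ i) (gaussianReal 0 (σ i).toNNReal) :=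
    (integrable_sub_sq 0 0 _).div_const _
  have h2 : Integrable (fun x : ℝ => (x - 0) ^ 2 / σ i - 1) (gaussianReal 0 (σ i).toNNReal) :=
    h1.sub (integrable_const _)
  have h3 : Integrable (fun x : ℝ => x) (gaussianReal 0 (σ i).toNNReal) :=
    (memLp_id_gaussianReal 1).integrable (by simp)
  have hcomp : ∀ f : ℝ → ℝ, Integrable f (gaussianReal 0 (σ i).toNNReal) →
      ∫ e, f (e i) ∂(gaussianLaw 0 σ) = ∫ x, f x ∂(gaussianReal 0 (σ i).toNNReal) := by
    intro f hf
    rw [← hmp.map_eq, integral_map hmp.measurable.aemeasurable]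
    rw [hmp.map_eq]; exact hf.aestronglyMeasurable
  refine ⟨?_, ?_, hmp.integrable_comp_of_integrable h3, ?_⟩
  · simpa [Function.comp_def] using hmp.integrable_comp_of_integrable h2
  · have h4 := hcomp _ h2
    simp only [sub_zero] at h4 h1
    rw [h4, integral_sub h1 (integrable_const _), integral_div]
    have h5 := integral_sub_sq 0 0 (σ i).toNNReal
    simp only [sub_zero] at h5
    rw [h5, Real.coe_toNNReal _ (hσ i).le]
    simp [(hσ i).ne']
  · rw [hcomp _ h3, integral_id_gaussianReal]

/-- The fluctuations are integrable and centred. -/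
lemma Admissible.integral_fluct (h : m.Admissible σ σ₀ γ θ) (s : Fin (2 ^ kn) → ℝ) :
    Integrable (fun z : (Fin (2 ^ kn) → ℝ) × (Fin (2 ^ kn) → ℝ) => m.fluct s σ z.1 z.2)
        ((gaussianLaw 0 σ).prod (gaussianLaw s σ)) ∧
      ∫ z, m.fluct s σ z.1 z.2 ∂((gaussianLaw 0 σ).prod (gaussianLaw s σ)) = 0 := by
  have hinv : ∀ i, Integrable (fun y => (m.varEst y i)⁻¹) (gaussianLaw s σ) := by
    intro i
    simp_rw [varEst_eq, inv_div]
    have hm : Measurable fun y => m.len / m.rss (m.block i) y :=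
      (m.measurable_rss _).const_div _
    refine (lintegral_ofReal_ne_top_iff_integrable hm.aestronglyMeasurable
      (Filter.Eventually.of_forall fun y => div_nonneg (Nat.cast_nonneg _) (rss_nonneg _ _))).1 ?_
    have h1 := h.lintegral_inv_rss_pow_le s (m.block i) (i := 1) (by linarith [m.two_le_order])
    simp only [pow_one] at h1
    exact (h1.trans_lt ENNReal.ofReal_lt_top).ne
  -- Each summand is a difference of products of a centred function of the first noise and a
  -- function of the second sample, integrable because the inverse estimated variance has a finite
  -- mean.
  have hdec : ∀ z : (Fin (2 ^ kn) → ℝ) × (Fin (2 ^ kn) → ℝ), m.fluct s σ z.1 z.2 =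
      ∑ i, ((z.1 i ^ 2 / σ i - 1) * ((1 / 2) * (1 - σ i * (m.varEst z.2 i)⁻¹)) -
        z.1 i * ((s i - m.proj s i) * (m.varEst z.2 i)⁻¹)) := by
    intro z
    refine Finset.sum_congr rfl fun i _ => ?_
    ring
  simp_rw [hdec]
  have ha : ∀ i, Integrable (fun y => (1 / 2) * (1 - σ i * (m.varEst y i)⁻¹)) (gaussianLaw s σ) :=
    fun i => ((integrable_const _).sub ((hinv i).const_mul _)).const_mul _
  have hb : ∀ i, Integrable (fun y => (s i - m.proj s i) * (m.varEst y i)⁻¹) (gaussianLaw s σ) :=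
    fun i => (hinv i).const_mul _
  have hc := fun i => integrable_coord_sq h.var_pos i
  have h1 := fun i => (hc i).1.mul_prod (ha i)
  have h2 := fun i => (hc i).2.2.1.mul_prod (hb i)
  have h3 : ∀ i, Integrable (fun z : (Fin (2 ^ kn) → ℝ) × (Fin (2 ^ kn) → ℝ) =>
      (z.1 i ^ 2 / σ i - 1) * ((1 / 2) * (1 - σ i * (m.varEst z.2 i)⁻¹)) -
        z.1 i * ((s i - m.proj s i) * (m.varEst z.2 i)⁻¹))
      ((gaussianLaw 0 σ).prod (gaussianLaw s σ)) := fun i => (h1 i).sub (h2 i)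
  refine ⟨integrable_finsetSum _ fun i _ => h3 i, ?_⟩
  rw [integral_finsetSum _ fun i _ => h3 i]
  refine Finset.sum_eq_zero fun i _ => ?_
  rw [integral_sub (h1 i) (h2 i),
    integral_prod_mul (fun e : Fin (2 ^ kn) → ℝ => e i ^ 2 / σ i - 1)
      (fun y => (1 / 2) * (1 - σ i * (m.varEst y i)⁻¹)),
    integral_prod_mul (fun e : Fin (2 ^ kn) → ℝ => e i)
      (fun y => (s i - m.proj s i) * (m.varEst y i)⁻¹), (hc i).2.1, (hc i).2.2.2]
  simp

/-- The mean excess of the error term of a model. -/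
lemma Admissible.lintegral_excess_le (h : m.Admissible σ σ₀ γ θ) {α x pen : ℝ} (hα : 0 < α)
    (hα1 : α < 1) (hx : 0 < x) (hpen : γ * θ * m.D + x ≤ pen) (s : Fin (2 ^ kn) → ℝ) :
    ∫⁻ z, ENNReal.ofReal (m.fluct s σ z.1 z.2 + ∑ b, m.noise b z.1 z.2 - pen -
        α * m.lossReal s σ z.1 z.2) ∂((gaussianLaw 0 σ).prod (gaussianLaw s σ)) ≤
      ENNReal.ofReal (constC * θ ^ 2 * γ * (√(m.card : ℝ) * (m.d : ℝ) *
        (2 * constC * θ ^ 2 * γ * √(m.card : ℝ) * (m.d : ℝ) * Real.log (1 + (m.d : ℝ)) / x) ^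
          ⌊2 * Real.log (1 + (m.d : ℝ))⌋₊)) +
      ENNReal.ofReal ((2 * (α + γ * θ) + 1) / α * ((m.card : ℝ) *
        Real.exp (-((2 ^ kn : ℝ) / (2 * θ * (m.card : ℝ))) *
          Real.log (1 + α * (m.card : ℝ) * x / (γ * (2 ^ kn : ℝ) * (α + 2)))))) := by
  refine le_trans ?_ (add_le_add (h.lintegral_noise_excess_le s hx)
    (h.lintegral_fluct_excess_le hα hα1 hx s))
  rw [← lintegral_add_left]
  · refine lintegral_mono fun z => ?_
    -- Of the weight `x`, one half is spent on the noise and one quarter on the fluctuations; the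
    -- last quarter is not needed.
    refine le_trans (ENNReal.ofReal_le_ofReal ?_) ENNReal.ofReal_add_le
    have h1 := m.bias_le_lossReal s σ z.1 z.2 fun b => rss_nonneg _ _
    have h2 := mul_le_mul_of_nonneg_left h1 hα.le
    linarith
  · have : Measurable fun z : (Fin (2 ^ kn) → ℝ) × (Fin (2 ^ kn) → ℝ) => ∑ b, m.noise b z.1 z.2 :=
      Finset.measurable_sum _ fun b _ => m.measurable_noise b
    fun_prop

end Model

end HeteroGauss

/-! ### The oracle inequality. -/

theorem theorem4
    -- the Gaussian vector: `n = 2 ^ kn`, its mean `s` and its variances `σ`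
    (kn : ℕ) (s σ : Fin (2 ^ kn) → ℝ) (hσ : ∀ i, 0 < σ i)
    (γ : ℝ) (hγ : 1 ≤ γ) (hσγ : ∀ i j, σ i ≤ γ * σ j)
    -- two independent copies of it
    {Ω : Type*} [MeasurableSpace Ω] (P : Measure Ω) [IsProbabilityMeasure P]
    (Y₁ Y₂ : Ω → Fin (2 ^ kn) → ℝ)
    (hY₁ : HasLaw Y₁ (HeteroGauss.gaussianLaw s σ) P)
    (hY₂ : HasLaw Y₂ (HeteroGauss.gaussianLaw s σ) P)
    (hY : IndepFun Y₁ Y₂ P)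
    -- the collection of models, and the hypothesis `(H_θ)`
    {M : Type*} [Countable M] (model : M → HeteroGauss.Model kn)
    (θ : ℝ) (hθ : 1 < θ)
    (hHθ : ∀ m, θ / (θ - 1) * (γ + 2) * ((model m).D : ℝ) ≤ (2 ^ kn : ℝ))
    -- the weights and the penalty
    (α : ℝ) (hα : α ∈ Set.Ioo (0 : ℝ) 1)
    (x : M → ℝ) (hx : ∀ m, 0 < x m)
    (pen : M → ℝ) (hpen : ∀ m, γ * θ * ((model m).D : ℝ) + x m ≤ pen m)
    -- the selected model: any (measurable) minimizer of the penalized criterion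
    (mhat : Ω → M) (hmhat : ∀ m, MeasurableSet (mhat ⁻¹' {m}))
    (hmin : ∀ᵐ ω ∂P, ∀ m,
      HeteroGauss.crit (model (mhat ω)) (pen (mhat ω)) (Y₁ ω) (Y₂ ω) ≤
        HeteroGauss.crit (model m) (pen m) (Y₁ ω) (Y₂ ω)) :
    ENNReal.ofReal (1 - α) * ∫⁻ ω, (model (mhat ω)).loss s σ (Y₁ ω) (Y₂ ω) ∂P ≤
      (⨅ m, ((∫⁻ ω, (model m).loss s σ (Y₁ ω) (Y₂ ω) ∂P) + ENNReal.ofReal (pen m))) +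
        HeteroGauss.R₁ model x γ θ + HeteroGauss.R₂ model x γ θ α := by
  -- reduction to the centred noise `Y₁ - s`
  have : Nonempty (Fin (2 ^ kn)) := ⟨⟨0, by positivity⟩⟩
  obtain ⟨i₀, hi₀⟩ := Finite.exists_min σ
  -- The reference scale `σ₀` is the smallest variance.
  have hadm : ∀ m, (model m).Admissible σ (σ i₀) γ θ := fun m =>
    ⟨hσ i₀, hi₀, fun i => hσγ i i₀, hγ, hθ, hHθ m⟩
  have hnoise : HasLaw (fun ω => Y₁ ω - s) (HeteroGauss.gaussianLaw 0 σ) P := by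
    refine ⟨hY₁.aemeasurable.sub_const s, ?_⟩
    have h := AEMeasurable.map_map_of_aemeasurable (g := fun y : Fin (2 ^ kn) → ℝ => y - s)
      (measurable_id.sub_const s).aemeasurable hY₁.aemeasurable
    rw [hY₁.map_eq, HeteroGauss.map_sub_gaussianLaw] at h
    exact h.symm
  have hind : IndepFun (fun ω => Y₁ ω - s) Y₂ P :=
    hY.comp (φ := fun y => y - s) (ψ := id) (measurable_id.sub_const s) measurable_id
  set Z : Ω → (Fin (2 ^ kn) → ℝ) × (Fin (2 ^ kn) → ℝ) := fun ω => (Y₁ ω - s, Y₂ ω) with hZdef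
  have hZ : HasLaw Z ((HeteroGauss.gaussianLaw 0 σ).prod (HeteroGauss.gaussianLaw s σ)) P :=
    hind.hasLaw_prod hnoise hY₂
  have hadd : ∀ ω, s + (Z ω).1 = Y₁ ω := fun ω => add_sub_cancel s (Y₁ ω)
  have hpos : ∀ᵐ ω ∂P, ∀ m, ∀ b, 0 < (model m).rss b (Y₂ ω) := by
    refine ae_all_iff.2 fun m => ?_
    have h := (hadm m).ae_rss_pos s
    rw [← hY₂.map_eq] at h
    exact ae_of_ae_map hY₂.aemeasurable h
  have hα0 := hα.1
  have hα1 := hα.2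
  -- the error term of each model
  set D : M → Ω → ℝ≥0∞ := fun m ω => ENNReal.ofReal ((model m).fluct s σ (Z ω).1 (Z ω).2 +
    ∑ b, (model m).noise b (Z ω).1 (Z ω).2 - pen m -
      α * (model m).lossReal s σ (Z ω).1 (Z ω).2) with hD
  have hDmeas' : ∀ m, Measurable fun z : (Fin (2 ^ kn) → ℝ) × (Fin (2 ^ kn) → ℝ) =>
      ENNReal.ofReal ((model m).fluct s σ z.1 z.2 + ∑ b, (model m).noise b z.1 z.2 - pen m -
        α * (model m).lossReal s σ z.1 z.2) := fun m => by
    have h1 := (model m).measurable_fluct (σ := σ) s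
    have h2 : Measurable fun z : (Fin (2 ^ kn) → ℝ) × (Fin (2 ^ kn) → ℝ) =>
        ∑ b, (model m).noise b z.1 z.2 :=
      Finset.measurable_sum _ fun b _ => (model m).measurable_noise b
    have h3 := (model m).measurable_lossReal (σ := σ) s
    fun_prop
  have hDmeas : ∀ m, AEMeasurable (D m) P := fun m => (hDmeas' m).comp_aemeasurable hZ.aemeasurable
  have hDsum : ∫⁻ ω, ∑' m, D m ω ∂P ≤
      HeteroGauss.R₁ model x γ θ + HeteroGauss.R₂ model x γ θ α := by
    rw [lintegral_tsum hDmeas, HeteroGauss.R₁, HeteroGauss.R₂, ← ENNReal.tsum_mul_left,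
      ← ENNReal.tsum_mul_left, ← ENNReal.tsum_add]
    refine ENNReal.tsum_le_tsum fun m => ?_
    have h := (hadm m).lintegral_excess_le hα0 hα1 (hx m) (hpen m) s
    rw [← hZ.lintegral_comp (hDmeas' m).aemeasurable] at h
    refine h.trans (le_of_eq ?_)
    have hC := HeteroGauss.le_constC
    rw [ENNReal.ofReal_mul (p := HeteroGauss.constC * θ ^ 2 * γ)
      (mul_nonneg (mul_nonneg (by linarith) (sq_nonneg θ)) (by linarith)),
      ENNReal.ofReal_mul (p := (2 * (α + γ * θ) + 1) / α)
      (div_nonneg (by have : 0 ≤ γ * θ := mul_nonneg (by linarith) (by linarith)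
                      linarith) hα0.le)]
  rw [add_assoc, ENNReal.iInf_add]
  refine le_iInf fun m => ?_
  -- the fluctuations of the reference model are centred
  obtain ⟨hAint, hAzero⟩ := (hadm m).integral_fluct s
  have hAmeas := (model m).measurable_fluct (σ := σ) s
  set A : Ω → ℝ := fun ω => (model m).fluct s σ (Z ω).1 (Z ω).2 with hA
  have hAm : AEMeasurable A P := hAmeas.comp_aemeasurable hZ.aemeasurable
  have hAi : Integrable A P := by
    rw [← hZ.map_eq] at hAint
    exact hAint.comp_aemeasurable hZ.aemeasurable
  have hA0 : ∫ ω, A ω ∂P = 0 := by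
    rw [← hZ.map_eq, integral_map hZ.aemeasurable hAmeas.aestronglyMeasurable] at hAzero
    exact hAzero
  have hApos : ∫⁻ ω, ENNReal.ofReal (A ω) ∂P ≠ ⊤ := hAi.lintegral_lt_top.ne
  have hAneg : ∫⁻ ω, ENNReal.ofReal (-A ω) ∂P ≠ ⊤ := hAi.neg.lintegral_lt_top.ne
  -- In `[0, ∞]` the signed term `-A` is encoded by adding `A⁺` on the left and `A⁻` on the right;
  -- their integrals are equal and finite, hence cancel at the end.
  have hAeq : ∫⁻ ω, ENNReal.ofReal (A ω) ∂P = ∫⁻ ω, ENNReal.ofReal (-A ω) ∂P := by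
    rw [integral_eq_lintegral_pos_part_sub_lintegral_neg_part hAi, sub_eq_zero] at hA0
    exact (ENNReal.toReal_eq_toReal_iff' hApos hAneg).1 hA0
  have hpoint : ∀ᵐ ω ∂P, ENNReal.ofReal (1 - α) * (model (mhat ω)).loss s σ (Y₁ ω) (Y₂ ω) +
      ENNReal.ofReal (A ω) ≤ (model m).loss s σ (Y₁ ω) (Y₂ ω) + ENNReal.ofReal (pen m) +
        ENNReal.ofReal (-A ω) + ∑' m, D m ω := by
    filter_upwards [hmin, hpos] with ω hminω hposω
    have h1 := hminω m
    have hK := (model m).likelihood_sub_eq s σ (Z ω).1 (Y₂ ω) hσ (hposω m)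
    have hK' := (model (mhat ω)).likelihood_sub_eq s σ (Z ω).1 (Y₂ ω) hσ (hposω (mhat ω))
    have hL := (model m).loss_eq s σ (Z ω).1 (Y₂ ω) hσ (hposω m)
    have hL' := (model (mhat ω)).loss_eq s σ (Z ω).1 (Y₂ ω) hσ (hposω (mhat ω))
    have hK0 := (model (mhat ω)).lossReal_nonneg s σ (Z ω).1 (Y₂ ω) hσ (hposω (mhat ω))
    -- The noise of the reference model enters with a favourable sign and is dropped.
    have hB : 0 ≤ ∑ b, (model m).noise b (Z ω).1 (Y₂ ω) :=
      Finset.sum_nonneg fun b _ => (model m).noise_nonneg b _ _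
    rw [hadd] at hK hK' hL hL'
    rw [HeteroGauss.crit, HeteroGauss.crit] at h1
    rw [hL, hL', ← ENNReal.ofReal_mul (by linarith)]
    have hmaxA : ENNReal.ofReal (A ω) = ENNReal.ofReal (max (A ω) 0) := by
      rcases le_total 0 (A ω) with h | h
      · rw [max_eq_left h]
      · rw [max_eq_right h, ENNReal.ofReal_of_nonpos h, ENNReal.ofReal_zero]
    have hmaxA' : max (A ω) 0 ≤ A ω + max (-A ω) 0 := by
      rcases le_total 0 (A ω) with h | h
      · rw [max_eq_left h]; linarith [le_max_right (-A ω) 0]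
      · rw [max_eq_right h]; linarith [le_max_left (-A ω) 0]
    have hmaxN : ENNReal.ofReal (max (-A ω) 0) = ENNReal.ofReal (-A ω) := by
      rcases le_total 0 (-A ω) with h | h
      · rw [max_eq_left h]
      · rw [max_eq_right h, ENNReal.ofReal_of_nonpos h, ENNReal.ofReal_zero]
    rw [hmaxA, ← hmaxN, ← ENNReal.ofReal_add (mul_nonneg (by linarith) hK0) (le_max_right _ _)]
    -- The error at the random index is bounded by the sum over all models.
    refine le_trans ?_ (add_le_add le_rfl (ENNReal.le_tsum (f := fun m => D m ω) (mhat ω)))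
    refine le_trans (ENNReal.ofReal_le_ofReal ?_) (ENNReal.ofReal_add_le.trans
      (add_le_add (ENNReal.ofReal_add_le.trans (add_le_add ENNReal.ofReal_add_le le_rfl)) le_rfl))
    have hAω : A ω = (model m).fluct s σ (Z ω).1 (Y₂ ω) := rfl
    have hZ2 : (Z ω).2 = Y₂ ω := rfl
    rw [hZ2]
    linarith
  have hmain := lintegral_mono_ae hpoint
  have hSm : AEMeasurable (fun ω => ∑' m, D m ω) P := AEMeasurable.tsum hDmeas
  have hNm : AEMeasurable (fun ω => ENNReal.ofReal (-A ω)) P := hAm.neg.ennreal_ofReal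
  -- Additivity needs measurability of one summand only, which is here never a loss.
  rw [lintegral_add_right' _ hAm.ennreal_ofReal, lintegral_const_mul' _ _ ENNReal.ofReal_ne_top,
    lintegral_add_right' _ hSm, lintegral_add_right' _ hNm,
    lintegral_add_right _ measurable_const, lintegral_const, measure_univ, mul_one, hAeq,
    add_right_comm] at hmain
  exact (ENNReal.le_of_add_le_add_right hAneg hmain).trans (add_le_add le_rfl hDsum)
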